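/- Let $\nu\in\{2,3\}$ and let $M$ be a smooth connected curve of finite length immersed in $\mathbb R^\nu$, either closed or an arc, with arc length $s$ and curvature $\kappa$. For $V$ real-valued, bounded and measurable on $M$, let $H=-\frac{d^2}{ds^2}+V(s)$ be the self-adjoint operator on $L^2(M)$ defined as the Friedrichs extension from $C_c^\infty(M)$, where an arc is taken without its end points. Thus the form domain is $W^1_0(M)$, and Dirichlet conditions hold at the end points if $M$ is not closed. Let $\lambda_1\le\lambda_2\le\cdots$ be the eigenvalues of $H$ counted with multiplicity, $u_1$ a real-valued normalized eigenfunction for $\lambda_1$, and $\Gamma=\lambda_2-\lambda_1$. 1. For every such $M$ and $V$, $$\Gamma\le 4\int_M\left(\left(\frac{du_1}{ds}\right)^2+\frac{\kappa^2}{4}u_1^2\right)ds,$$ where the right-hand side may be $+\infty$ if $\kappa$ is unbounded near an end point of an arc. 2. Suppose that $\kappa$ is bounded (which is automatic if $M$ is closed, or an arc that is smooth up to its end points), and let $g>0$. Then for $H_g=-\frac{d^2}{ds^2}+g\kappa^2$ one has $\lambda_1>0$ and $$\Gamma\le\max\left(4,\frac1g\right)\lambda_1,\qquad\text{equivalently}\qquad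 \frac{\lambda_2}{\lambda_1}\le\max\left(5,1+\frac1g\right).$$ 3. The bounds in 2 are sharp for $0<g\le\frac14$: for every such $g$, both are equalities when $M$ is a circle in $\mathbb R^\nu$, traversed once. -/

import Mathlib

open MeasureTheory Set
open scoped ContDiff

noncomputable section

/-- A smooth connected immersed curve of finite length in `ℝ^ν`, parametrized by arc length `s`.
Either it is an arc, with parameter interval `(0, length)` (no regularity is required at the end
points, so arcs that are smooth up to their end points are included), or it is a smooth closed
curve, given by a smooth periodic parametrization of period `length`.  Values of `toFun` outside
`(0, length)` are irrelevant for an arc. -/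
structure ArcLengthCurve (ν : ℕ) where
  length : ℝ
  length_pos : 0 < length
  toFun : ℝ → EuclideanSpace ℝ (Fin ν)
  smooth : ContDiffOn ℝ ∞ toFun (Ioo 0 length)
  unit_speed : ∀ s ∈ Ioo 0 length, ‖deriv toFun s‖ = 1
  /-- whether the curve is regarded as a closed curve -/
  IsClosedCurve : Prop
  closed : IsClosedCurve → ContDiff ℝ ∞ toFun ∧ Function.Periodic toFun length

namespace ArcLengthCurve

variable {ν : ℕ} (M : ArcLengthCurve ν)

/-- The curvature `κ(s) = |γ''(s)|`. -/
def curvature (s : ℝ) : ℝ := ‖deriv (deriv M.toFun) s‖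

/-- The arc length measure. -/
def arcMeasure : Measure ℝ := volume.restrict (Ioo 0 M.length)

/-- The real Hilbert space `L²(M, ds)`. -/
abbrev L2 : Type := Lp ℝ 2 M.arcMeasure

/-- The test functions `C_c^∞(M)` in the arc length parameter: smooth functions with compact
support in `(0, length)` for an arc, smooth periodic functions for a closed curve. -/
def IsTestFunction (φ : ℝ → ℝ) : Prop :=
  ContDiff ℝ ∞ φ ∧
  (M.IsClosedCurve → Function.Periodic φ M.length) ∧
  (¬ M.IsClosedCurve → HasCompactSupport φ ∧ tsupport φ ⊆ Ioo 0 M.length)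

/-- The Sobolev space `W_0^1(M)`, the completion of `C_c^∞(M)` in the `W^1` norm, as the set of
pairs `(u, du/ds)`: the closure in `L² × L²` of the pairs `(φ, φ')` with `φ` a test function. -/
def sobolev : Set (M.L2 × M.L2) :=
  closure {p | ∃ φ : ℝ → ℝ, M.IsTestFunction φ ∧
    p.1 =ᵐ[M.arcMeasure] φ ∧ p.2 =ᵐ[M.arcMeasure] deriv φ}

/-- The graph of the self-adjoint operator `H = -d²/ds² + V` (the Friedrichs extension from
`C_c^∞(M)`) for a bounded potential `V`: the pair `(u, f)` belongs to it, i.e. `u` is in the domain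
of `H` and `H u = f`, if and only if `u` lies in the form domain `W_0^1(M)`, `f` lies in `L²(M)`,
and `∫ (u' φ' + V u φ) ds = ∫ f φ ds` for every `φ` in the form domain. -/
def schrodingerGraph (V : ℝ → ℝ) : Set (M.L2 × M.L2) :=
  {p | ∃ u' : M.L2, (p.1, u') ∈ M.sobolev ∧ ∀ φ φ' : M.L2, (φ, φ') ∈ M.sobolev →
    ∫ s, (u' s * φ' s + V s * p.1 s * φ s) ∂M.arcMeasure
      = ∫ s, p.2 s * φ s ∂M.arcMeasure}

/-- The `k`-th eigenvalue `λ_k` (`k = 1, 2, …`) of `H = -d²/ds² + V`, in increasing order and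
counted with multiplicity: the least `t` such that there are `k` linearly independent
eigenfunctions of `H` with eigenvalues at most `t`. -/
def eigenvalue (V : ℝ → ℝ) (k : ℕ) : ℝ :=
  sInf {t | ∃ v : Fin k → M.L2, LinearIndependent ℝ v ∧
    ∀ i, ∃ μ : ℝ, μ ≤ t ∧ (v i, μ • v i) ∈ M.schrodingerGraph V}

/-- The fundamental gap `Γ = λ₂ - λ₁`. -/
def gap (V : ℝ → ℝ) : ℝ := M.eigenvalue V 2 - M.eigenvalue V 1

/-- The potential `g κ²`, so that `H_g = -d²/ds² + g κ²`. -/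
def curvaturePotential (g : ℝ) (s : ℝ) : ℝ := g * M.curvature s ^ 2

/-- The circle of radius `R` and center `c`, traversed once, in the plane through `c` spanned by
the orthonormal vectors `e 0` and `e 1`. -/
def circle (R : ℝ) (hR : 0 < R) (c : EuclideanSpace ℝ (Fin ν))
    (e : Fin 2 → EuclideanSpace ℝ (Fin ν)) (he : Orthonormal ℝ e) : ArcLengthCurve ν where
  length := 2 * Real.pi * R
  length_pos := by positivity
  toFun s := c + ((R * Real.cos (s / R)) • e 0 + (R * Real.sin (s / R)) • e 1)
  smooth := by
    apply ContDiff.contDiffOn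
    fun_prop
  unit_speed := by
    intro s _
    have h1 : HasDerivAt (fun s : ℝ => R * Real.cos (s / R)) (- Real.sin (s / R)) s := by
      refine (((hasDerivAt_id' s).div_const R).cos.const_mul R).congr_deriv ?_
      field_simp
    have h2 : HasDerivAt (fun s : ℝ => R * Real.sin (s / R)) (Real.cos (s / R)) s := by
      refine (((hasDerivAt_id' s).div_const R).sin.const_mul R).congr_deriv ?_
      field_simp
    have h3 := ((h1.smul_const (e 0)).add (h2.smul_const (e 1))).const_add c
    have h4 : deriv (fun s : ℝ => c + ((R * Real.cos (s / R)) • e 0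
        + (R * Real.sin (s / R)) • e 1)) s
        = (- Real.sin (s / R)) • e 0 + Real.cos (s / R) • e 1 := h3.deriv
    rw [h4]
    have h01 : inner ℝ (e 0) (e 1) = (0 : ℝ) := he.2 (by decide)
    have hsq : ‖(- Real.sin (s / R)) • e 0 + Real.cos (s / R) • e 1‖ ^ 2 = 1 := by
      rw [norm_add_sq_real, inner_smul_left, inner_smul_right, h01, norm_smul, norm_smul,
        he.1 0, he.1 1]
      simp
    nlinarith [norm_nonneg ((- Real.sin (s / R)) • e 0 + Real.cos (s / R) • e 1)]
  IsClosedCurve := True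
  closed := by
    intro _
    refine ⟨by fun_prop, ?_⟩
    intro s
    have h : (s + 2 * Real.pi * R) / R = s / R + 2 * Real.pi := by field_simp
    simp only [h, Real.cos_add_two_pi, Real.sin_add_two_pi]

/-- `M` is a circle, traversed once. -/
def IsCircle : Prop :=
  ∃ (R : ℝ) (hR : 0 < R) (c : EuclideanSpace ℝ (Fin ν)) (e : Fin 2 → EuclideanSpace ℝ (Fin ν))
    (he : Orthonormal ℝ e), M = circle R hR c e he

end ArcLengthCurve

end

/-! The gap bound is a commutator estimate with the Cartesian coordinates of the curve as
multipliers. Let `u` be a normalized ground state and `G` a smooth function with `Gu` orthogonal to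
`u`. Testing the eigenvalue equation with `G²u` shows that `Gu` has energy `λ₁‖Gu‖² + ‖G'u‖²`, so
the variational principle for `λ₂` gives `Γ‖Gu‖² ≤ ‖G'u‖²` (`gap_mul_norm_sq_le`). Integrating
`(GG'u²)'` gives `‖G'u‖² = -⟨Gu, G''u + 2G'u'⟩` (`norm_mulOp_deriv_sq`). Cauchy–Schwarz eliminates
`‖Gu‖`, leaving `Γ‖X'u‖² ≤ ‖X''u + 2X'u'‖²` for every coordinate `X`, since subtracting a constant
from `X` changes neither side. Summed over the coordinates, `∑X'² = 1`, `∑X'X'' = 0` and `∑X''² =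
κ²` turn this into the first bound (`gap_le_integral`).

For `V = gκ²` the energy identity `λ₁ = ‖u'‖² + g‖κu‖²` turns the right-hand side `4‖u'‖² + ‖κu‖²`
into at most `max(4, 1/g) λ₁`. On a circle of radius `R` the constants give `λ₁ = g/R²`, and
Wirtinger's inequality gives `λ₂ ≥ (g+1)/R²`, which is equality when `g ≤ 1/4`.

All of this uses forms only. The existence of eigenvalues and their variational description come
from minimizing the energy, with compactness from Arzelà–Ascoli. -/

noncomputable section

/-! ### Minimizers of a quadratic form on a closed subspace of pairs `(u, u')`. -/

section Variational

open Filter Topology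

variable {E : Type*} [NormedAddCommGroup E] [InnerProductSpace ℝ E]

/-- The energy form `⟨x₂, y₂⟩ + ⟨A x₁, y₁⟩` on pairs `(u, u')`. -/
def energyForm (A : E →L[ℝ] E) (x y : E × E) : ℝ :=
  inner ℝ x.2 y.2 + inner ℝ (A x.1) y.1

/-- The quadratic form of `energyForm`. -/
def energy (A : E →L[ℝ] E) (x : E × E) : ℝ := energyForm A x x

variable {A : E →L[ℝ] E}

lemma energyForm_comm (hA : ∀ x y, inner ℝ (A x) y = inner ℝ x (A y)) (x y : E × E) :
    energyForm A x y = energyForm A y x := by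
  simp only [energyForm]
  rw [real_inner_comm, hA, real_inner_comm x.1]

lemma energy_add_smul (hA : ∀ x y, inner ℝ (A x) y = inner ℝ x (A y)) (x y : E × E) (t : ℝ) :
    energy A (x + t • y) = energy A x + 2 * t * energyForm A x y + t ^ 2 * energy A y := by
  have h := energyForm_comm hA x y
  simp only [energy, energyForm, Prod.fst_add, Prod.snd_add, Prod.smul_fst, Prod.smul_snd, map_add,
    map_smul, inner_add_left, inner_add_right, inner_smul_left, inner_smul_right] at h ⊢
  simp only [conj_trivial]
  linear_combination (-t) * h

lemma norm_add_smul_sq (x y : E) (t : ℝ) :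
    ‖x + t • y‖ ^ 2 = ‖x‖ ^ 2 + 2 * t * inner ℝ x y + t ^ 2 * ‖y‖ ^ 2 := by
  rw [norm_add_sq_real, inner_smul_right, norm_smul, mul_pow, Real.norm_eq_abs, sq_abs]
  ring

lemma energy_smul (x : E × E) (t : ℝ) : energy A (t • x) = t ^ 2 * energy A x := by
  simp only [energy, energyForm, Prod.smul_fst, Prod.smul_snd, map_smul, inner_smul_left,
    inner_smul_right, conj_trivial]
  ring

lemma abs_inner_apply_le (A : E →L[ℝ] E) (u : E) : |inner ℝ (A u) u| ≤ ‖A‖ * ‖u‖ ^ 2 := by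
  refine (abs_real_inner_le_norm _ _).trans ?_
  have := A.le_opNorm u
  nlinarith [norm_nonneg u]

/-- A bound on the energy and on `u` thus controls `u'`; this keeps minimizing sequences bounded. -/
lemma energy_ge (x : E × E) : ‖x.2‖ ^ 2 - ‖A‖ * ‖x.1‖ ^ 2 ≤ energy A x := by
  have h := abs_le.1 (abs_inner_apply_le A x.1)
  simp only [energy, energyForm, real_inner_self_eq_norm_sq]
  linarith [h.1]

/-- The minimum of the energy over the unit vectors of a closed subspace is attained, provided that
bounded sequences of the subspace have first components with convergent subsequences. -/
theorem exists_energy_minimizer [CompleteSpace E]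
    (hA : ∀ x y, inner ℝ (A x) y = inner ℝ x (A y)) (K : Submodule ℝ (E × E))
    (hK : IsClosed (K : Set (E × E)))
    (hc : ∀ (x : ℕ → E × E) (C : ℝ), (∀ n, x n ∈ K) → (∀ n, ‖x n‖ ≤ C) →
      ∃ a : E, ∃ θ : ℕ → ℕ, StrictMono θ ∧ Tendsto (fun n => (x (θ n)).1) atTop (𝓝 a))
    (hne : ∃ x ∈ K, x.1 ≠ 0) :
    ∃ p ∈ K, ‖p.1‖ = 1 ∧ ∀ x ∈ K, energy A p * ‖x.1‖ ^ 2 ≤ energy A x := by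
  set S : Set ℝ := {e | ∃ x ∈ K, ‖x.1‖ = 1 ∧ energy A x = e}
  have hSne : S.Nonempty := by
    obtain ⟨x, hx, hx1⟩ := hne
    refine ⟨_, (‖x.1‖⁻¹ : ℝ) • x, K.smul_mem _ hx, ?_, rfl⟩
    rw [Prod.smul_fst, norm_smul, norm_inv, norm_norm, inv_mul_cancel₀ (norm_ne_zero_iff.2 hx1)]
  have hSb : BddBelow S := by
    refine ⟨-‖A‖, ?_⟩
    rintro _ ⟨x, -, hx1, rfl⟩
    have := energy_ge (A := A) x
    rw [hx1] at this
    nlinarith [sq_nonneg ‖x.2‖]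
  set m := sInf S
  have hmle : ∀ x ∈ K, m * ‖x.1‖ ^ 2 ≤ energy A x := by
    intro x hx
    by_cases h0 : x.1 = 0
    · have := energy_ge (A := A) x
      simp only [h0, norm_zero] at this ⊢
      nlinarith [sq_nonneg ‖x.2‖]
    · have hpos : 0 < ‖x.1‖ := norm_pos_iff.2 h0
      have : m ≤ energy A ((‖x.1‖⁻¹ : ℝ) • x) := by
        refine csInf_le hSb ⟨_, K.smul_mem _ hx, ?_, rfl⟩
        rw [Prod.smul_fst, norm_smul, norm_inv, norm_norm, inv_mul_cancel₀ hpos.ne']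
      rw [energy_smul, inv_pow, ← div_eq_inv_mul, le_div_iff₀ (by positivity)] at this
      exact this
  obtain ⟨e, -, he, heS⟩ := exists_seq_tendsto_sInf hSne hSb
  choose x hxK hx1 hxe using heS
  obtain ⟨Ce, hCe⟩ := he.bddAbove_range
  have hbound : ∀ n, ‖x n‖ ≤ 1 + (|Ce| + ‖A‖) := by
    intro n
    have h1 := energy_ge (A := A) (x n)
    have h2 : e n ≤ Ce := hCe ⟨n, rfl⟩
    rw [hxe, hx1] at h1
    have h3 := le_abs_self Ce
    have h4 := norm_nonneg A
    rw [Prod.norm_def, hx1]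
    refine max_le (by linarith [abs_nonneg Ce]) ?_
    nlinarith [sq_nonneg (‖(x n).2‖ - 1), abs_nonneg Ce]
  obtain ⟨a, θ, hθ, hlim⟩ := hc x _ hxK hbound
  have he' : Tendsto (fun n => e (θ n)) atTop (𝓝 m) := he.comp hθ.tendsto_atTop
  have hcau1 : CauchySeq (fun n => (x (θ n)).1) := hlim.cauchySeq
  -- Parallelogram law: the energy of the sum is at least `m` times its squared norm, so the energy
  -- of the difference is small once `e i`, `e j` are near `m` and the first components are close.
  have hpar : ∀ i j, ‖(x i).2 - (x j).2‖ ^ 2 ≤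
      2 * (e i - m) + 2 * (e j - m) + (|m| + ‖A‖) * ‖(x i).1 - (x j).1‖ ^ 2 := by
    intro i j
    have h1 := hmle _ (K.add_mem (hxK i) (hxK j))
    have h2 := energy_add_smul hA (x i) (x j) 1
    have h3 := energy_add_smul hA (x i) (x j) (-1)
    have h4 := norm_add_smul_sq (x i).1 (x j).1 1
    have h5 := norm_add_smul_sq (x i).1 (x j).1 (-1)
    have h6 := energy_ge (A := A) (x i + (-1 : ℝ) • x j)
    simp only [one_smul, neg_smul, ← sub_eq_add_neg, Prod.fst_add, Prod.fst_sub, Prod.snd_sub, hxe,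
      hx1] at *
    have h7 := le_abs_self m
    have h8 : ‖(x i).1 + (x j).1‖ ^ 2 = 4 - ‖(x i).1 - (x j).1‖ ^ 2 := by linarith
    rw [h8] at h1
    have h9 := mul_le_mul_of_nonneg_right h7 (sq_nonneg ‖(x i).1 - (x j).1‖)
    linarith
  have hcau2 : CauchySeq (fun n => (x (θ n)).2) := by
    rw [Metric.cauchySeq_iff] at hcau1 ⊢
    intro ε hε
    set B := |m| + ‖A‖ + 1 with hB
    have hBpos : 0 < B := by positivity
    obtain ⟨N1, hN1⟩ := hcau1 (ε / (2 * B)) (by positivity)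
    obtain ⟨N2, hN2⟩ := (Metric.tendsto_atTop.1 he') (ε ^ 2 / 16) (by positivity)
    refine ⟨max N1 N2, fun i hi j hj => ?_⟩
    have h1 := hN1 i (le_of_max_le_left hi) j (le_of_max_le_left hj)
    have h2 := (abs_lt.1 (hN2 i (le_of_max_le_right hi))).2
    have h3 := (abs_lt.1 (hN2 j (le_of_max_le_right hj))).2
    rw [dist_eq_norm] at h1 ⊢
    have h4 := hpar (θ i) (θ j)
    have hB1 : 1 ≤ B := by rw [hB]; linarith [abs_nonneg m, norm_nonneg A]
    have h5 : (|m| + ‖A‖) * ‖(x (θ i)).1 - (x (θ j)).1‖ ^ 2 ≤ ε ^ 2 / 4 := by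
      have : ‖(x (θ i)).1 - (x (θ j)).1‖ ^ 2 ≤ (ε / (2 * B)) ^ 2 := by gcongr
      calc _ ≤ B * (ε / (2 * B)) ^ 2 := by gcongr; linarith
        _ = ε ^ 2 / 4 / B := by field_simp; norm_num
        _ ≤ _ := div_le_self (by positivity) hB1
    refine lt_of_pow_lt_pow_left₀ 2 hε.le ?_
    nlinarith [sq_pos_of_pos hε]
  obtain ⟨b, hb⟩ := cauchySeq_tendsto_of_complete hcau2
  have hlim' : Tendsto (fun n => x (θ n)) atTop (𝓝 (a, b)) := hlim.prodMk_nhds hb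
  have hcont : Continuous (energy A) := by
    unfold energy energyForm
    fun_prop
  have hen : energy A (a, b) = m := by
    refine tendsto_nhds_unique (hcont.continuousAt.tendsto.comp hlim') ?_
    simpa only [Function.comp_def, hxe] using he'
  refine ⟨(a, b), hK.mem_of_tendsto hlim' (Eventually.of_forall fun n => hxK _), ?_, ?_⟩
  · refine tendsto_nhds_unique hlim.norm ?_
    simp only [hx1, tendsto_const_nhds]
  · rw [hen]; exact hmle

/-- The Euler–Lagrange equation of a minimizer. -/
theorem energyForm_eq_of_minimizer
    (hA : ∀ x y, inner ℝ (A x) y = inner ℝ x (A y)) (K : Submodule ℝ (E × E))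
    {p : E × E} (hp : p ∈ K) (hp1 : ‖p.1‖ = 1)
    (hmin : ∀ x ∈ K, energy A p * ‖x.1‖ ^ 2 ≤ energy A x) {x : E × E} (hx : x ∈ K) :
    energyForm A p x = energy A p * inner ℝ p.1 x.1 := by
  have key : ∀ t : ℝ, 0 ≤ 2 * t * (energyForm A p x - energy A p * inner ℝ p.1 x.1)
      + t ^ 2 * (energy A x - energy A p * ‖x.1‖ ^ 2) := by
    intro t
    have h := hmin _ (K.add_mem hp (K.smul_mem t hx))
    rw [energy_add_smul hA, Prod.fst_add, Prod.smul_fst, norm_add_smul_sq, hp1] at h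
    linarith
  set b := energyForm A p x - energy A p * inner ℝ p.1 x.1 with hb
  set c := energy A x - energy A p * ‖x.1‖ ^ 2 with hcdef
  have hc0 : 0 ≤ c := sub_nonneg.2 (hmin x hx)
  -- This `t` minimizes `2tb + t²(c+1)`; `c + 1` replaces `c` because `c` may vanish.
  have h := key (-b / (c + 1))
  have h2 : 2 * (-b / (c + 1)) * b + (-b / (c + 1)) ^ 2 * c
      = - (b ^ 2 * (c + 2)) / (c + 1) ^ 2 := by
    field_simp
    ring
  rw [h2, neg_div, Left.nonneg_neg_iff] at h
  have h3 : b ^ 2 * (c + 2) ≤ 0 := by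
    by_contra hcon
    exact absurd h (not_le.2 (div_pos (not_le.1 hcon) (by positivity)))
  have h4 : b ^ 2 = 0 := by nlinarith [sq_nonneg b]
  have h5 : b = 0 := by simpa using h4
  linarith

end Variational

/-! ### Multiplication operators on `L²`. -/

section Multiplication

open scoped ENNReal

variable {α : Type*} [MeasurableSpace α] {μ : Measure α}

/-- Multiplication by an essentially bounded function as an operator on `L²`. -/
def mulOp {F : α → ℝ} (hF : MemLp F ∞ μ) : Lp ℝ 2 μ →L[ℝ] Lp ℝ 2 μ :=
  (ContinuousLinearMap.mul ℝ ℝ).holderL μ ∞ 2 2 (hF.toLp F)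

lemma coeFn_mulOp {F : α → ℝ} (hF : MemLp F ∞ μ) (u : Lp ℝ 2 μ) :
    mulOp hF u =ᵐ[μ] fun x => F x * u x := by
  have h : mulOp hF u =ᵐ[μ] fun x => hF.toLp F x * u x :=
    ContinuousLinearMap.coeFn_holder (r := 2) (ContinuousLinearMap.mul ℝ ℝ) (hF.toLp F) u
  filter_upwards [h, hF.coeFn_toLp] with x h1 h2
  rw [h1, h2]

lemma inner_eq_integral_mul (f g : Lp ℝ 2 μ) : inner ℝ f g = ∫ x, f x * g x ∂μ := by
  rw [L2.inner_def]
  refine integral_congr_ae (Filter.Eventually.of_forall fun x => ?_)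
  simp [mul_comm]

lemma integrable_mul_L2 (f g : Lp ℝ 2 μ) : Integrable (fun x => f x * g x) μ :=
  (Lp.memLp f).integrable_mul (Lp.memLp g)

lemma norm_sq_eq_integral (f : Lp ℝ 2 μ) : ‖f‖ ^ 2 = ∫ x, f x ^ 2 ∂μ := by
  rw [← real_inner_self_eq_norm_sq, inner_eq_integral_mul]
  simp only [sq]

lemma inner_mulOp {F : α → ℝ} (hF : MemLp F ∞ μ) (u v : Lp ℝ 2 μ) :
    inner ℝ (mulOp hF u) v = ∫ x, F x * u x * v x ∂μ := by
  rw [inner_eq_integral_mul]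
  refine integral_congr_ae ?_
  filter_upwards [coeFn_mulOp hF u] with x hx
  rw [hx]

lemma mulOp_symm {F : α → ℝ} (hF : MemLp F ∞ μ) (u v : Lp ℝ 2 μ) :
    inner ℝ (mulOp hF u) v = inner ℝ u (mulOp hF v) := by
  rw [inner_mulOp, real_inner_comm, inner_mulOp]
  refine integral_congr_ae (Filter.Eventually.of_forall fun x => ?_)
  simp only
  ring

lemma integrable_mulOp {F : α → ℝ} (hF : MemLp F ∞ μ) (u v : Lp ℝ 2 μ) :
    Integrable (fun x => F x * u x * v x) μ := by
  refine (integrable_mul_L2 (mulOp hF u) v).congr ?_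
  filter_upwards [coeFn_mulOp hF u] with x hx
  rw [hx]

end Multiplication

/-! ### Test functions, multipliers and the Sobolev space. -/

namespace ArcLengthCurve

open scoped ENNReal

variable {ν : ℕ} (M : ArcLengthCurve ν)

instance : IsFiniteMeasure M.arcMeasure := by
  unfold arcMeasure; infer_instance

variable {M}

lemma ae_arcMeasure {p : ℝ → Prop} (h : ∀ s ∈ Ioo 0 M.length, p s) : ∀ᵐ s ∂M.arcMeasure, p s :=
  (ae_restrict_iff' measurableSet_Ioo).2 (Filter.Eventually.of_forall h)

lemma integral_arcMeasure (f : ℝ → ℝ) :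
    ∫ s, f s ∂M.arcMeasure = ∫ s in (0 : ℝ)..M.length, f s := by
  rw [intervalIntegral.integral_of_le M.length_pos.le, integral_Ioc_eq_integral_Ioo, arcMeasure]

lemma memLp_top_of_continuousOn {F : ℝ → ℝ} (hF : ContinuousOn F (Ioo 0 M.length)) {K : ℝ}
    (hK : ∀ s ∈ Ioo 0 M.length, |F s| ≤ K) : MemLp F ∞ M.arcMeasure :=
  memLp_top_of_bound (hF.aestronglyMeasurable measurableSet_Ioo) K (ae_arcMeasure hK)

lemma memLp_top_of_continuous {F : ℝ → ℝ} (hF : Continuous F) : MemLp F ∞ M.arcMeasure := by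
  obtain ⟨K, hK⟩ := (isCompact_Icc (a := 0) (b := M.length)).exists_bound_of_continuousOn
    hF.continuousOn
  exact memLp_top_of_continuousOn hF.continuousOn fun s hs => hK s (Ioo_subset_Icc_self hs)

lemma memLp_two_of_continuous {F : ℝ → ℝ} (hF : Continuous F) : MemLp F 2 M.arcMeasure :=
  (memLp_top_of_continuous hF).mono_exponent le_top

lemma IsTestFunction.continuous {φ : ℝ → ℝ} (h : M.IsTestFunction φ) : Continuous φ :=
  h.1.continuous

lemma IsTestFunction.continuous_deriv {φ : ℝ → ℝ} (h : M.IsTestFunction φ) :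
    Continuous (deriv φ) :=
  h.1.continuous_deriv (by simp)

lemma IsTestFunction.differentiable {φ : ℝ → ℝ} (h : M.IsTestFunction φ) : Differentiable ℝ φ :=
  h.1.differentiable (by simp)

lemma IsTestFunction.zero : M.IsTestFunction (0 : ℝ → ℝ) :=
  ⟨contDiff_const, fun _ _ => rfl, fun _ => ⟨HasCompactSupport.zero, by
    simp [tsupport]⟩⟩

lemma IsTestFunction.add {φ ψ : ℝ → ℝ} (h : M.IsTestFunction φ) (h' : M.IsTestFunction ψ) :
    M.IsTestFunction (φ + ψ) :=
  ⟨h.1.add h'.1, fun hc => (h.2.1 hc).add (h'.2.1 hc), fun hc =>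
    ⟨(h.2.2 hc).1.add (h'.2.2 hc).1,
      (tsupport_add _ _).trans (union_subset (h.2.2 hc).2 (h'.2.2 hc).2)⟩⟩

/-- This common boundary property lets arcs and closed curves share the integration by parts and
Wirtinger's inequality. -/
lemma IsTestFunction.apply_zero_eq {φ : ℝ → ℝ} (h : M.IsTestFunction φ) : φ 0 = φ M.length := by
  by_cases hc : M.IsClosedCurve
  · simpa using (h.2.1 hc 0).symm
  · have h0 : ∀ x ∉ Ioo 0 M.length, φ x = 0 := fun x hx =>
      image_eq_zero_of_notMem_tsupport fun hx' => hx ((h.2.2 hc).2 hx')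
    rw [h0 0 (by simp), h0 M.length (by simp)]

lemma IsTestFunction.apply_zero {φ : ℝ → ℝ} (h : M.IsTestFunction φ) (hc : ¬ M.IsClosedCurve) :
    φ 0 = 0 :=
  image_eq_zero_of_notMem_tsupport fun hx' => by simpa using (h.2.2 hc).2 hx'

/-- The functions with which test functions can be multiplied: smooth functions on the open arc,
respectively smooth functions on the closed curve. -/
def IsMultiplier (M : ArcLengthCurve ν) (F : ℝ → ℝ) : Prop :=
  ContDiffOn ℝ ∞ F (Ioo 0 M.length) ∧
    (M.IsClosedCurve → ContDiff ℝ ∞ F ∧ Function.Periodic F M.length)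

lemma IsMultiplier.const (c : ℝ) : M.IsMultiplier fun _ => c :=
  ⟨contDiffOn_const, fun _ => ⟨contDiff_const, fun _ => rfl⟩⟩

lemma IsMultiplier.mul {F G : ℝ → ℝ} (hF : M.IsMultiplier F) (hG : M.IsMultiplier G) :
    M.IsMultiplier (fun s => F s * G s) :=
  ⟨hF.1.mul hG.1, fun hc => ⟨(hF.2 hc).1.mul (hG.2 hc).1, (hF.2 hc).2.mul (hG.2 hc).2⟩⟩

lemma IsMultiplier.sub {F G : ℝ → ℝ} (hF : M.IsMultiplier F) (hG : M.IsMultiplier G) :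
    M.IsMultiplier (fun s => F s - G s) :=
  ⟨hF.1.sub hG.1, fun hc => ⟨(hF.2 hc).1.sub (hG.2 hc).1, (hF.2 hc).2.sub (hG.2 hc).2⟩⟩

lemma IsMultiplier.differentiableAt {F : ℝ → ℝ} (hF : M.IsMultiplier F) {s : ℝ}
    (hs : s ∈ Ioo 0 M.length) : DifferentiableAt ℝ F s :=
  (hF.1.contDiffAt (isOpen_Ioo.mem_nhds hs)).differentiableAt (by simp)

lemma IsMultiplier.continuousOn {F : ℝ → ℝ} (hF : M.IsMultiplier F) :
    ContinuousOn F (Ioo 0 M.length) := hF.1.continuousOn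

lemma IsMultiplier.deriv {F : ℝ → ℝ} (hF : M.IsMultiplier F) : M.IsMultiplier (deriv F) := by
  refine ⟨hF.1.deriv_of_isOpen isOpen_Ioo (by simp), fun hc => ?_⟩
  obtain ⟨h1, h2⟩ := hF.2 hc
  refine ⟨(contDiff_infty_iff_deriv.1 h1).2, fun s => ?_⟩
  rw [← deriv_comp_add_const]
  congr 1
  funext x
  exact h2 x

lemma IsMultiplier.mul_test {F φ : ℝ → ℝ} (hF : M.IsMultiplier F) (hφ : M.IsTestFunction φ) :
    M.IsTestFunction (fun s => F s * φ s) := by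
  refine ⟨?_, fun hc => (hF.2 hc).2.mul (hφ.2.1 hc), fun hc => ⟨?_, ?_⟩⟩
  · by_cases hc : M.IsClosedCurve
    · exact (hF.2 hc).1.mul hφ.1
    · rw [contDiff_iff_contDiffAt]
      intro x
      -- On an arc `F` is smooth only inside the interval, which contains the support of `φ`; off
      -- the support the product is locally zero.
      by_cases hx : x ∈ tsupport φ
      · exact (hF.1.contDiffAt (isOpen_Ioo.mem_nhds ((hφ.2.2 hc).2 hx))).mul hφ.1.contDiffAt
      · refine (contDiffAt_const (c := (0 : ℝ))).congr_of_eventuallyEq ?_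
        filter_upwards [notMem_tsupport_iff_eventuallyEq.1 hx] with y hy
        simp [hy]
  · exact (hφ.2.2 hc).1.mul_left
  · exact (tsupport_mul_subset_right).trans (hφ.2.2 hc).2

lemma IsTestFunction.const_smul {φ : ℝ → ℝ} (h : M.IsTestFunction φ) (c : ℝ) :
    M.IsTestFunction (c • φ) :=
  (IsMultiplier.const c).mul_test h

variable (M)

/-- The pairs `(φ, φ')` of test functions and their derivatives. -/
def testGraph : Submodule ℝ (M.L2 × M.L2) where
  carrier := {p | ∃ φ : ℝ → ℝ, M.IsTestFunction φ ∧
    p.1 =ᵐ[M.arcMeasure] φ ∧ p.2 =ᵐ[M.arcMeasure] deriv φ}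
  zero_mem' := ⟨0, .zero, Lp.coeFn_zero _ _ _, by
    filter_upwards [Lp.coeFn_zero ℝ 2 M.arcMeasure] with x hx
    simpa using hx⟩
  add_mem' := by
    rintro p q ⟨φ, hφ, hp1, hp2⟩ ⟨ψ, hψ, hq1, hq2⟩
    refine ⟨φ + ψ, hφ.add hψ, (Lp.coeFn_add _ _).trans (hp1.add hq1), ?_⟩
    refine (Lp.coeFn_add _ _).trans ((hp2.add hq2).trans (Filter.EventuallyEq.of_eq ?_))
    funext x
    exact (deriv_add (hφ.differentiable x) (hψ.differentiable x)).symm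
  smul_mem' := by
    rintro c p ⟨φ, hφ, hp1, hp2⟩
    refine ⟨c • φ, hφ.const_smul c, (Lp.coeFn_smul _ _).trans (hp1.const_smul c), ?_⟩
    refine (Lp.coeFn_smul _ _).trans ((hp2.const_smul c).trans (Filter.EventuallyEq.of_eq ?_))
    funext x
    exact (deriv_const_smul c (hφ.differentiable x)).symm

/-- The Sobolev space `W_0^1(M)` as a submodule. -/
def sobolevSubmodule : Submodule ℝ (M.L2 × M.L2) := M.testGraph.topologicalClosure

variable {M}

lemma isClosed_sobolevSubmodule : IsClosed (M.sobolevSubmodule : Set (M.L2 × M.L2)) :=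
  M.testGraph.isClosed_topologicalClosure

/-- A property of pairs which defines a closed set and holds for test functions holds on
`W_0^1(M)`. -/
lemma sobolev_induction {P : M.L2 × M.L2 → Prop} (hc : IsClosed {p | P p})
    (h : ∀ (p : M.L2 × M.L2) (φ : ℝ → ℝ), M.IsTestFunction φ → p.1 =ᵐ[M.arcMeasure] φ →
      p.2 =ᵐ[M.arcMeasure] deriv φ → P p) {p : M.L2 × M.L2} (hp : p ∈ M.sobolev) : P p := by
  refine closure_minimal (t := {p | P p}) ?_ hc hp
  rintro q ⟨φ, hφ, h1, h2⟩
  exact h q φ hφ h1 h2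

/-- The pair `(φ, φ')` in `W_0^1(M)` of a test function. -/
lemma IsTestFunction.mem_sobolev {φ : ℝ → ℝ} (h : M.IsTestFunction φ) :
    ((memLp_two_of_continuous h.continuous).toLp φ,
      (memLp_two_of_continuous h.continuous_deriv).toLp (_root_.deriv φ)) ∈ M.sobolev :=
  subset_closure ⟨φ, h, (memLp_two_of_continuous h.continuous).coeFn_toLp,
    (memLp_two_of_continuous h.continuous_deriv).coeFn_toLp⟩

/-- Integration by parts in `W_0^1(M)` against a smooth function. -/
lemma integral_weak_deriv {p : M.L2 × M.L2} (hp : p ∈ M.sobolev) {ψ : ℝ → ℝ}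
    (hψ : ContDiff ℝ ∞ ψ)
    (hb : ∀ φ, M.IsTestFunction φ → φ 0 * ψ 0 = φ M.length * ψ M.length) :
    ∫ s, (p.1 s * deriv ψ s + p.2 s * ψ s) ∂M.arcMeasure = 0 := by
  have hψ' : Continuous (deriv ψ) := hψ.continuous_deriv (by simp)
  set P := (memLp_two_of_continuous (M := M) hψ.continuous).toLp ψ with hP
  set P' := (memLp_two_of_continuous (M := M) hψ').toLp (deriv ψ) with hP'
  have hPc : P =ᵐ[M.arcMeasure] ψ := MemLp.coeFn_toLp _
  have hPc' : P' =ᵐ[M.arcMeasure] deriv ψ := MemLp.coeFn_toLp _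
  -- As a sum of inner products the identity is a closed condition on `q`, so test functions
  -- suffice.
  have key : ∀ q : M.L2 × M.L2, inner ℝ q.1 P' + inner ℝ q.2 P
      = ∫ s, (q.1 s * deriv ψ s + q.2 s * ψ s) ∂M.arcMeasure := by
    intro q
    rw [inner_eq_integral_mul, inner_eq_integral_mul,
      ← integral_add (integrable_mul_L2 _ _) (integrable_mul_L2 _ _)]
    refine integral_congr_ae ?_
    filter_upwards [hPc, hPc'] with s h1 h2
    rw [h1, h2]
  rw [← key]
  refine sobolev_induction (P := fun q => inner ℝ q.1 P' + inner ℝ q.2 P = 0) ?_ ?_ hp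
  · exact isClosed_eq (by fun_prop) continuous_const
  · intro q φ hφ h1 h2
    rw [key]
    have : ∫ s, (q.1 s * deriv ψ s + q.2 s * ψ s) ∂M.arcMeasure
        = ∫ s, (φ s * deriv ψ s + deriv φ s * ψ s) ∂M.arcMeasure := by
      refine integral_congr_ae ?_
      filter_upwards [h1, h2] with s h1 h2
      rw [h1, h2]
    rw [this, integral_arcMeasure, intervalIntegral.integral_eq_sub_of_hasDerivAt
      (f := fun s => φ s * ψ s)]
    · rw [hb φ hφ, sub_self]
    · intro s _
      refine ((hφ.differentiable s).hasDerivAt.mul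
        ((hψ.differentiable (by simp)) s).hasDerivAt).congr_deriv ?_
      ring
    · exact ((hφ.continuous.mul hψ').add (hφ.continuous_deriv.mul hψ.continuous)).intervalIntegrable
        _ _

/-- Integration by parts in `W_0^1(M)` against a test function. -/
lemma integral_weak_deriv_test {p : M.L2 × M.L2} (hp : p ∈ M.sobolev) {ψ : ℝ → ℝ}
    (hψ : M.IsTestFunction ψ) :
    ∫ s, (p.1 s * deriv ψ s + p.2 s * ψ s) ∂M.arcMeasure = 0 :=
  integral_weak_deriv hp hψ.1 fun φ hφ => by rw [hφ.apply_zero_eq, hψ.apply_zero_eq]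

/-- The weak derivative is determined by the function. -/
lemma sobolev_snd_eq_zero {w : M.L2} (hw : ((0 : M.L2), w) ∈ M.sobolev) : w = 0 := by
  have h := isOpen_Ioo.ae_eq_zero_of_integral_contDiff_smul_eq_zero (μ := volume)
    (U := Ioo 0 M.length) (f := w) ?_ ?_
  · refine Lp.ext ?_
    have h' : ∀ᵐ s ∂M.arcMeasure, w s = 0 := (ae_restrict_iff' measurableSet_Ioo).2 h
    filter_upwards [h', Lp.coeFn_zero ℝ 2 M.arcMeasure] with s h1 h2
    rw [h1, h2]; rfl
  · have : IntegrableOn w (Ioo 0 M.length) volume := (Lp.memLp w).integrable (by norm_num)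
    exact this.locallyIntegrableOn
  · intro ψ hψ _ hs
    have h0 : ∀ x ∉ Ioo 0 M.length, ψ x = 0 := fun x hx =>
      image_eq_zero_of_notMem_tsupport fun hx' => hx (hs hx')
    have h1 := integral_weak_deriv hw hψ fun φ _ => by
      rw [h0 0 (by simp), h0 M.length (by simp)]; simp
    have h2 : ∫ s, ψ s • w s = ∫ s, ψ s • w s ∂M.arcMeasure := by
      refine (setIntegral_eq_integral_of_forall_compl_eq_zero fun x hx => ?_).symm
      rw [h0 x hx, zero_smul]
    rw [h2, ← h1]
    refine integral_congr_ae ?_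
    filter_upwards [Lp.coeFn_zero ℝ 2 M.arcMeasure] with s h3
    simp only [h3, smul_eq_mul, Pi.zero_apply]
    ring

lemma sobolev_unique {u v w : M.L2} (hv : (u, v) ∈ M.sobolev) (hw : (u, w) ∈ M.sobolev) :
    v = w := by
  -- `sobolev` and the carrier of `sobolevSubmodule` are the same closure by definition.
  have := M.sobolevSubmodule.sub_mem hv hw
  rw [Prod.mk_sub_mk, sub_self] at this
  exact sub_eq_zero.1 (sobolev_snd_eq_zero this)

/-- Multiplication by a bounded smooth function with bounded derivative preserves `W_0^1(M)`. -/
lemma IsMultiplier.mul_mem_sobolev {F : ℝ → ℝ} (hF : M.IsMultiplier F)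
    (h : MemLp F ∞ M.arcMeasure) (h' : MemLp (_root_.deriv F) ∞ M.arcMeasure)
    {p : M.L2 × M.L2} (hp : p ∈ M.sobolev) :
    (mulOp h p.1, mulOp h' p.1 + mulOp h p.2) ∈ M.sobolev := by
  refine sobolev_induction
    (P := fun q => (mulOp h q.1, mulOp h' q.1 + mulOp h q.2) ∈ M.sobolev) ?_ ?_ hp
  · exact isClosed_closure.preimage (by fun_prop)
  · intro q φ hφ h1 h2
    refine subset_closure ⟨_, hF.mul_test hφ, ?_, ?_⟩
    · filter_upwards [coeFn_mulOp h q.1, h1] with s h3 h4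
      rw [h3, h4]
    · have hd : ∀ s ∈ Ioo 0 M.length, _root_.deriv (fun s => F s * φ s) s
          = _root_.deriv F s * φ s + F s * _root_.deriv φ s := fun s hs =>
        ((hF.differentiableAt hs).hasDerivAt.mul (hφ.differentiable s).hasDerivAt).deriv
      filter_upwards [Lp.coeFn_add (mulOp h' q.1) (mulOp h q.2), coeFn_mulOp h' q.1,
        coeFn_mulOp h q.2, h1, h2, ae_arcMeasure hd] with s h3 h4 h5 h6 h7 h8
      rw [h3, Pi.add_apply, h4, h5, h6, h7, h8]

end ArcLengthCurve

/-! ### One-dimensional Sobolev estimates and Rellich compactness. -/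

lemma sq_sub_le_integral_deriv_sq {φ : ℝ → ℝ} (hφ : Differentiable ℝ φ)
    (hφ' : Continuous (deriv φ)) {a b x y : ℝ} (hx : a ≤ x) (hxy : x ≤ y) (hy : y ≤ b) :
    (φ y - φ x) ^ 2 ≤ (y - x) * ∫ s in a..b, deriv φ s ^ 2 := by
  have hI : ∀ c d : ℝ, IntervalIntegrable (fun s => deriv φ s ^ 2) volume c d :=
    fun c d => (hφ'.pow 2).intervalIntegrable c d
  have h1 : ∫ s in x..y, deriv φ s = φ y - φ x :=
    intervalIntegral.integral_deriv_eq_sub (fun s _ => hφ s) (hφ'.intervalIntegrable _ _)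
  have hmono : ∫ s in x..y, deriv φ s ^ 2 ≤ ∫ s in a..b, deriv φ s ^ 2 :=
    intervalIntegral.integral_mono_interval hx hxy hy
      (Filter.Eventually.of_forall fun s => sq_nonneg _) (hI a b)
  rcases hxy.eq_or_lt with rfl | hlt
  · simp
  -- With `c` the mean slope, expanding `∫(φ' - c)² ≥ 0` is exactly the Cauchy–Schwarz bound.
  set c := (φ y - φ x) / (y - x) with hc
  have h2 : 0 ≤ ∫ s in x..y, (deriv φ s - c) ^ 2 :=
    intervalIntegral.integral_nonneg hxy fun s _ => sq_nonneg _
  have h3 : ∫ s in x..y, (deriv φ s - c) ^ 2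
      = (∫ s in x..y, deriv φ s ^ 2) - 2 * c * (φ y - φ x) + c ^ 2 * (y - x) := by
    have : ∀ s, (deriv φ s - c) ^ 2 = deriv φ s ^ 2 - 2 * c * deriv φ s + c ^ 2 := fun s => by ring
    simp only [this]
    rw [intervalIntegral.integral_add ((hI x y).sub ((hφ'.intervalIntegrable _ _).const_mul _))
        intervalIntegrable_const,
      intervalIntegral.integral_sub (hI x y) ((hφ'.intervalIntegrable _ _).const_mul _),
      intervalIntegral.integral_const_mul, h1, intervalIntegral.integral_const, smul_eq_mul]
    ring
  have hpos : 0 < y - x := sub_pos.2 hlt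
  have h4 : (∫ s in x..y, deriv φ s ^ 2) - 2 * c * (φ y - φ x) + c ^ 2 * (y - x)
      = (∫ s in x..y, deriv φ s ^ 2) - (φ y - φ x) ^ 2 / (y - x) := by
    rw [hc]; field_simp; ring
  rw [h3, h4] at h2
  have h5 : (φ y - φ x) ^ 2 / (y - x) ≤ ∫ s in a..b, deriv φ s ^ 2 := by linarith
  rw [div_le_iff₀ hpos] at h5
  linarith

lemma sq_sub_le_dist_mul_integral_deriv_sq {φ : ℝ → ℝ} (hφ : Differentiable ℝ φ)
    (hφ' : Continuous (deriv φ)) {a b x y : ℝ} (hx : x ∈ Icc a b) (hy : y ∈ Icc a b) :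
    (φ x - φ y) ^ 2 ≤ dist x y * ∫ s in a..b, deriv φ s ^ 2 := by
  rcases le_total x y with h | h
  · have := sq_sub_le_integral_deriv_sq hφ hφ' hx.1 h hy.2
    rw [dist_comm, Real.dist_eq, abs_of_nonneg (sub_nonneg.2 h)]
    linarith
  · have := sq_sub_le_integral_deriv_sq hφ hφ' hy.1 h hx.2
    rwa [Real.dist_eq, abs_of_nonneg (sub_nonneg.2 h)]

/-- Integrate `φ(x)² ≤ 2φ(s)² + 2(φ(x) - φ(s))²` over `s`. -/
lemma mul_sq_le_integral_sq_add {φ : ℝ → ℝ} (hφ : Differentiable ℝ φ)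
    (hφ' : Continuous (deriv φ)) {b x : ℝ} (hx : x ∈ Icc 0 b) :
    b * φ x ^ 2 ≤ 2 * (∫ s in (0 : ℝ)..b, φ s ^ 2)
      + 2 * b ^ 2 * ∫ s in (0 : ℝ)..b, deriv φ s ^ 2 := by
  have hb : 0 ≤ b := hx.1.trans hx.2
  set J := ∫ s in (0 : ℝ)..b, deriv φ s ^ 2 with hJ
  have hJ0 : 0 ≤ J := intervalIntegral.integral_nonneg hb fun s _ => sq_nonneg _
  have h : ∫ _ in (0 : ℝ)..b, φ x ^ 2 ≤ ∫ s in (0 : ℝ)..b, (2 * φ s ^ 2 + 2 * b * J) := by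
    refine intervalIntegral.integral_mono_on hb (by simp)
      (((hφ.continuous.pow 2).const_mul 2).add continuous_const |>.intervalIntegrable _ _) ?_
    intro s hs
    have h1 := sq_sub_le_dist_mul_integral_deriv_sq hφ hφ' hx hs
    have h2 : dist x s ≤ b := by
      have := Real.dist_le_of_mem_Icc hx hs
      linarith
    have h3 := mul_le_mul_of_nonneg_right h2 hJ0
    nlinarith [sq_nonneg (φ x - 2 * φ s)]
  have hI : IntervalIntegrable (fun s => 2 * φ s ^ 2) volume 0 b :=
    ((hφ.continuous.pow 2).const_mul 2).intervalIntegrable _ _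
  rw [intervalIntegral.integral_const, intervalIntegral.integral_add
    hI (by simp), intervalIntegral.integral_const, intervalIntegral.integral_const_mul, smul_eq_mul,
    smul_eq_mul, sub_zero] at h
  linarith

namespace ArcLengthCurve

open Filter Topology

variable {ν : ℕ} {M : ArcLengthCurve ν}

lemma norm_sq_eq_integral_of_ae_eq {u : M.L2} {φ : ℝ → ℝ} (h : u =ᵐ[M.arcMeasure] φ) :
    ‖u‖ ^ 2 = ∫ s in (0 : ℝ)..M.length, φ s ^ 2 := by
  rw [norm_sq_eq_integral, ← integral_arcMeasure]
  refine integral_congr_ae ?_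
  filter_upwards [h] with s hs
  rw [hs]

/-- An `L²` bound on `φ` and `φ'` gives a uniform bound and a common Hölder-1/2 modulus, so
Arzelà–Ascoli applies on the closed interval. -/
lemma exists_subseq_tendsto_of_testGraph (x : ℕ → M.L2 × M.L2) (C : ℝ)
    (hx : ∀ n, x n ∈ M.testGraph) (hC : ∀ n, ‖x n‖ ≤ C) :
    ∃ a : M.L2, ∃ θ : ℕ → ℕ, StrictMono θ ∧ Tendsto (fun n => (x (θ n)).1) atTop (𝓝 a) := by
  choose φ hφ h1 h2 using hx
  have hC0 : 0 ≤ C := (norm_nonneg _).trans (hC 0)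
  have hL := M.length_pos
  have hn1 : ∀ n, ∫ s in (0 : ℝ)..M.length, φ n s ^ 2 ≤ C ^ 2 := fun n => by
    rw [← norm_sq_eq_integral_of_ae_eq (h1 n)]
    have := (norm_fst_le (x n)).trans (hC n)
    gcongr
  have hn2 : ∀ n, ∫ s in (0 : ℝ)..M.length, deriv (φ n) s ^ 2 ≤ C ^ 2 := fun n => by
    rw [← norm_sq_eq_integral_of_ae_eq (h2 n)]
    have := (norm_snd_le (x n)).trans (hC n)
    gcongr
  set B := Real.sqrt ((2 * C ^ 2 + 2 * M.length ^ 2 * C ^ 2) / M.length) with hB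
  have hsup : ∀ n, ∀ s ∈ Icc 0 M.length, |φ n s| ≤ B := fun n s hs => by
    refine Real.abs_le_sqrt ?_
    rw [le_div_iff₀ hL, mul_comm]
    refine (mul_sq_le_integral_sq_add (hφ n).differentiable (hφ n).continuous_deriv hs).trans ?_
    have := hn1 n
    have := hn2 n
    gcongr
  let f : ℕ → BoundedContinuousFunction (Icc 0 M.length) ℝ := fun n =>
    BoundedContinuousFunction.mkOfCompact
      ⟨fun s => φ n s, (hφ n).continuous.comp continuous_subtype_val⟩
  have hf : ∀ n s, f n s = φ n s := fun n s => rfl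
  have hcomp : IsCompact (closure (range f)) := by
    refine BoundedContinuousFunction.arzela_ascoli (Icc (-B) B) isCompact_Icc _ ?_ ?_
    · rintro _ s ⟨n, rfl⟩
      exact abs_le.1 (hsup n s s.2)
    · have hlim : Tendsto (fun t : ℝ => Real.sqrt (t * C ^ 2)) (𝓝 0) (𝓝 0) := by
        have : Continuous fun t : ℝ => Real.sqrt (t * C ^ 2) := by fun_prop
        simpa using this.tendsto 0
      refine Metric.equicontinuous_of_continuity_modulus _ hlim _ ?_
      rintro s t ⟨_, n, rfl⟩
      rw [Real.dist_eq]
      refine Real.abs_le_sqrt ?_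
      refine (sq_sub_le_dist_mul_integral_deriv_sq (hφ n).differentiable (hφ n).continuous_deriv
        s.2 t.2).trans ?_
      exact mul_le_mul_of_nonneg_left (hn2 n) dist_nonneg
  obtain ⟨_, -, θ, hθ, hlim⟩ := hcomp.tendsto_subseq (x := f) fun n => subset_closure ⟨n, rfl⟩
  -- The square root of the total arc length, which compares the `L²` distance with the sup
  -- distance.
  set c : ℝ := NNReal.toReal (measureUnivNNReal M.arcMeasure ^ (2 : ENNReal).toReal⁻¹) with hc
  have hdist : ∀ i j, dist (x i).1 (x j).1 ≤ c * dist (f i) (f j) := fun i j => by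
    rw [dist_eq_norm]
    have := Lp.norm_le_of_ae_bound (f := (x i).1 - (x j).1) (dist_nonneg (x := f i) (y := f j)) ?_
    · simpa [hc] using this
    filter_upwards [Lp.coeFn_sub (x i).1 (x j).1, h1 i, h1 j,
      ae_arcMeasure (M := M) (p := fun s => s ∈ Ioo 0 M.length) fun s hs => hs] with s e1 e2 e3 e4
    rw [e1, Pi.sub_apply, e2, e3]
    exact BoundedContinuousFunction.dist_coe_le_dist (f := f i) (g := f j)
      ⟨s, Ioo_subset_Icc_self e4⟩
  have hcau : CauchySeq (fun n => (x (θ n)).1) := by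
    have h := hlim.cauchySeq
    rw [Metric.cauchySeq_iff] at h ⊢
    intro ε hε
    have hc0 : 0 ≤ c := NNReal.coe_nonneg _
    obtain ⟨N, hN⟩ := h (ε / (c + 1)) (by positivity)
    refine ⟨N, fun i hi j hj => ?_⟩
    have h3 := hN i hi j hj
    rw [lt_div_iff₀ (by positivity)] at h3
    have h4 := hdist (θ i) (θ j)
    have h5 : 0 ≤ dist (f (θ i)) (f (θ j)) := dist_nonneg
    simp only [Function.comp_apply] at h3
    linarith
  obtain ⟨a, ha⟩ := cauchySeq_tendsto_of_complete hcau
  exact ⟨a, θ, hθ, ha⟩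

/-- Rellich's theorem: bounded sequences in `W_0^1(M)` have subsequences converging in `L²(M)`. -/
theorem exists_subseq_tendsto_of_sobolev (x : ℕ → M.L2 × M.L2) (C : ℝ)
    (hx : ∀ n, x n ∈ M.sobolev) (hC : ∀ n, ‖x n‖ ≤ C) :
    ∃ a : M.L2, ∃ θ : ℕ → ℕ, StrictMono θ ∧ Tendsto (fun n => (x (θ n)).1) atTop (𝓝 a) := by
  have happ : ∀ n, ∃ y ∈ M.testGraph, dist (x n) y < 1 / ((n : ℝ) + 1) := fun n =>
    Metric.mem_closure_iff.1 (hx n) _ (by positivity)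
  choose y hy hxy using happ
  have hyC : ∀ n, ‖y n‖ ≤ C + 1 := fun n => by
    have h1 : ‖y n‖ ≤ ‖x n‖ + dist (x n) (y n) := by
      rw [dist_eq_norm]; exact norm_le_norm_add_norm_sub _ _
    have h2 : 1 / ((n : ℝ) + 1) ≤ 1 := by
      rw [div_le_one (by positivity)]; linarith [n.cast_nonneg (α := ℝ)]
    linarith [hC n, hxy n]
  obtain ⟨a, θ, hθ, ha⟩ := exists_subseq_tendsto_of_testGraph y _ hy hyC
  refine ⟨a, θ, hθ, ?_⟩
  refine (tendsto_iff_of_dist ?_).2 ha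
  have h0 : Tendsto (fun n : ℕ => 1 / ((n : ℝ) + 1)) atTop (𝓝 0) :=
    tendsto_one_div_add_atTop_nhds_zero_nat
  refine squeeze_zero (fun n => dist_nonneg) (fun n => ?_) (h0.comp hθ.tendsto_atTop)
  refine le_trans ?_ (hxy (θ n)).le
  rw [Prod.dist_eq]
  exact le_max_left _ _

end ArcLengthCurve

/-! ### The first two eigenvalues by the variational principle. -/

namespace ArcLengthCurve

open scoped ENNReal

variable {ν : ℕ} {M : ArcLengthCurve ν}

lemma eqOn_of_ae_eq {f g : ℝ → ℝ} (h : f =ᵐ[M.arcMeasure] g)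
    (hf : ContinuousOn f (Ioo 0 M.length)) (hg : ContinuousOn g (Ioo 0 M.length)) :
    EqOn f g (Ioo 0 M.length) :=
  Measure.eqOn_open_of_ae_eq h isOpen_Ioo hf hg

-- The two test functions `β` and `Fβ` are linearly independent, so the form domain leaves room for
-- a second eigenfunction.
variable (M) in
lemma exists_testFunction_pair : ∃ β F : ℝ → ℝ, ∃ s t : ℝ, M.IsTestFunction β ∧ M.IsMultiplier F ∧
    s ∈ Ioo 0 M.length ∧ t ∈ Ioo 0 M.length ∧ β s = 1 ∧ β t = 1 ∧ F s ≠ F t := by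
  have hL := M.length_pos
  have hs : M.length / 2 ∈ Ioo 0 M.length := ⟨by linarith, by linarith⟩
  have ht : M.length / 4 ∈ Ioo 0 M.length := ⟨by linarith, by linarith⟩
  by_cases hc : M.IsClosedCurve
  · have h1 : ContDiff ℝ ∞ fun s : ℝ => Real.cos (2 * Real.pi / M.length * s) := by fun_prop
    refine ⟨fun _ => 1, fun s => Real.cos (2 * Real.pi / M.length * s), _, _,
      ⟨contDiff_const, fun _ _ => rfl, fun h => absurd hc h⟩,
      ⟨h1.contDiffOn, fun _ => ⟨h1, fun s => ?_⟩⟩, hs, ht, rfl, rfl, ?_⟩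
    · have : 2 * Real.pi / M.length * (s + M.length)
          = 2 * Real.pi / M.length * s + 2 * Real.pi := by field_simp
      simp only [this, Real.cos_add_two_pi]
    · have e1 : 2 * Real.pi / M.length * (M.length / 2) = Real.pi := by field_simp
      have e2 : 2 * Real.pi / M.length * (M.length / 4) = Real.pi / 2 := by field_simp; norm_num
      simp only [e1, e2, Real.cos_pi, Real.cos_pi_div_two]
      norm_num
  · let b : ContDiffBump (M.length / 2) :=
      ⟨M.length / 4, M.length / 3, by linarith, by linarith⟩
    refine ⟨b, fun s => s, _, _, ⟨b.contDiff, fun h => absurd h hc, fun _ =>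
      ⟨b.hasCompactSupport, ?_⟩⟩, ⟨contDiffOn_id, fun h => absurd h hc⟩, hs, ht,
      b.one_of_mem_closedBall ?_, b.one_of_mem_closedBall ?_, by linarith⟩
    · rw [b.tsupport_eq, Real.closedBall_eq_Icc]
      intro x hx
      have h1 : b.rOut = M.length / 3 := rfl
      rw [h1] at hx
      exact ⟨by linarith [hx.1], by linarith [hx.2]⟩
    · exact Metric.mem_closedBall_self b.rIn_pos.le
    · have h1 : b.rIn = M.length / 4 := rfl
      rw [h1, Real.closedBall_eq_Icc]
      exact ⟨by linarith, by linarith⟩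

lemma IsTestFunction.exists_mem_sobolev {φ : ℝ → ℝ} (h : M.IsTestFunction φ) :
    ∃ x ∈ M.sobolevSubmodule, x.1 =ᵐ[M.arcMeasure] φ ∧ x.2 =ᵐ[M.arcMeasure] _root_.deriv φ :=
  ⟨_, h.mem_sobolev, (memLp_two_of_continuous h.continuous).coeFn_toLp,
    (memLp_two_of_continuous h.continuous_deriv).coeFn_toLp⟩

lemma ne_zero_of_ae_eq {u : M.L2} {φ : ℝ → ℝ} (h : u =ᵐ[M.arcMeasure] φ) (hφ : Continuous φ)
    {s : ℝ} (hs : s ∈ Ioo 0 M.length) (h0 : φ s ≠ 0) : u ≠ 0 := by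
  rintro rfl
  exact h0 (eqOn_of_ae_eq (g := 0) (h.symm.trans (Lp.coeFn_zero _ _ _)) hφ.continuousOn
    continuousOn_const hs)

/-- The form domain is at least two-dimensional. -/
lemma exists_sobolev_perp (u : M.L2) :
    ∃ x ∈ M.sobolevSubmodule, inner ℝ u x.1 = 0 ∧ x.1 ≠ 0 := by
  obtain ⟨β, F, s, t, hβ, hF, hs, ht, hβs, hβt, hFst⟩ := M.exists_testFunction_pair
  obtain ⟨x, hx, hx1, -⟩ := hβ.exists_mem_sobolev
  obtain ⟨y, hy, hy1, -⟩ := (hF.mul_test hβ).exists_mem_sobolev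
  by_cases h0 : inner ℝ u x.1 = 0
  · exact ⟨x, hx, h0, ne_zero_of_ae_eq hx1 hβ.continuous hs (by simp [hβs])⟩
  · set c := inner ℝ u y.1 / inner ℝ u x.1 with hc
    refine ⟨y - c • x, Submodule.sub_mem _ hy (Submodule.smul_mem _ _ hx), ?_, ?_⟩
    · rw [Prod.fst_sub, Prod.smul_fst, inner_sub_right, inner_smul_right, hc, div_mul_cancel₀ _ h0,
        sub_self]
    · have hae : (y - c • x).1 =ᵐ[M.arcMeasure] fun s => F s * β s - c * β s := by
        rw [Prod.fst_sub, Prod.smul_fst]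
        filter_upwards [Lp.coeFn_sub y.1 (c • x.1), Lp.coeFn_smul c x.1, hx1, hy1]
          with r e1 e2 e3 e4
        rw [e1, Pi.sub_apply, e2, Pi.smul_apply, e3, e4, smul_eq_mul]
      have hcont : Continuous fun s => F s * β s - c * β s :=
        (hF.mul_test hβ).continuous.sub (continuous_const.mul hβ.continuous)
      by_cases hFs : F s = c
      · refine ne_zero_of_ae_eq hae hcont ht ?_
        simp only [hβt, mul_one, sub_ne_zero, ← hFs]
        exact hFst.symm
      · refine ne_zero_of_ae_eq hae hcont hs ?_
        simpa only [hβs, mul_one, sub_ne_zero] using hFs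

variable {V : ℝ → ℝ} (hV : MemLp V ∞ M.arcMeasure)

include hV in
lemma mem_schrodingerGraph_iff {u f : M.L2} : (u, f) ∈ M.schrodingerGraph V ↔
    ∃ u' : M.L2, (u, u') ∈ M.sobolevSubmodule ∧ ∀ x ∈ M.sobolevSubmodule,
      energyForm (mulOp hV) (u, u') x = inner ℝ f x.1 := by
  have key : ∀ (u' : M.L2) (x : M.L2 × M.L2), energyForm (mulOp hV) (u, u') x
      = ∫ s, (u' s * x.2 s + V s * u s * x.1 s) ∂M.arcMeasure := fun u' x => by
    rw [energyForm, inner_mulOp, inner_eq_integral_mul,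
      ← integral_add (integrable_mul_L2 _ _) (integrable_mulOp hV _ _)]
  constructor
  · rintro ⟨u', h1, h2⟩
    refine ⟨u', h1, fun x hx => ?_⟩
    rw [key, inner_eq_integral_mul]
    exact h2 x.1 x.2 hx
  · rintro ⟨u', h1, h2⟩
    refine ⟨u', h1, fun φ φ' hφ => ?_⟩
    have := h2 (φ, φ') hφ
    rwa [key, inner_eq_integral_mul] at this

/-- Uniqueness of the weak derivative allows any `u'` paired with `u`, not only the one hidden in
the graph. -/
lemma energyForm_eq_of_mem_graph {u u' : M.L2} {μ : ℝ} (hu' : (u, u') ∈ M.sobolev)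
    (hu : (u, μ • u) ∈ M.schrodingerGraph V) {x : M.L2 × M.L2} (hx : x ∈ M.sobolev) :
    energyForm (mulOp hV) (u, u') x = μ * inner ℝ u x.1 := by
  obtain ⟨w, hw, h⟩ := (mem_schrodingerGraph_iff hV).1 hu
  rw [sobolev_unique hu' hw, h x hx, inner_smul_left]
  rfl

lemma energy_eq_of_mem_graph {u u' : M.L2} {μ : ℝ} (hu' : (u, u') ∈ M.sobolev)
    (hu : (u, μ • u) ∈ M.schrodingerGraph V) :
    energy (mulOp hV) (u, u') = μ * ‖u‖ ^ 2 := by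
  rw [energy, energyForm_eq_of_mem_graph hV hu' hu hu', real_inner_self_eq_norm_sq]

lemma exists_sobolev_of_mem_graph {u f : M.L2} (hu : (u, f) ∈ M.schrodingerGraph V) :
    ∃ u', (u, u') ∈ M.sobolev := by
  obtain ⟨u', h, -⟩ := hu
  exact ⟨u', h⟩

/-- The minimizer of the energy orthogonal to an eigenfunction is an eigenfunction. -/
theorem exists_eigenfunction_perp {u : M.L2} {μ₀ : ℝ}
    (hu : (u, μ₀ • u) ∈ M.schrodingerGraph V) :
    ∃ (w : M.L2) (μ : ℝ), ‖w‖ = 1 ∧ inner ℝ u w = 0 ∧ (w, μ • w) ∈ M.schrodingerGraph V ∧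
      ∀ x ∈ M.sobolevSubmodule, inner ℝ u x.1 = 0 → μ * ‖x.1‖ ^ 2 ≤ energy (mulOp hV) x := by
  set ℓ : M.L2 × M.L2 →L[ℝ] ℝ := (innerSL ℝ u).comp (ContinuousLinearMap.fst ℝ M.L2 M.L2)
  set K := M.sobolevSubmodule ⊓ LinearMap.ker ℓ.toLinearMap with hKdef
  have hmem : ∀ x, x ∈ K ↔ x ∈ M.sobolevSubmodule ∧ inner ℝ u x.1 = 0 := fun x => by
    rw [hKdef, Submodule.mem_inf, LinearMap.mem_ker]
    rfl
  have hKclosed : IsClosed (K : Set (M.L2 × M.L2)) := by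
    have : (K : Set (M.L2 × M.L2)) =
        (M.sobolevSubmodule : Set (M.L2 × M.L2)) ∩ {x | ℓ x = 0} := by
      ext x
      exact hmem x
    rw [this]
    exact isClosed_sobolevSubmodule.inter (isClosed_eq ℓ.continuous continuous_const)
  have hsymm := mulOp_symm hV
  obtain ⟨p, hp, hp1, hmin⟩ := exists_energy_minimizer hsymm K hKclosed
    (fun x C hx hC => exists_subseq_tendsto_of_sobolev x C (fun n => ((hmem _).1 (hx n)).1) hC)
    (by
      obtain ⟨x, hx, hx1, hx2⟩ := exists_sobolev_perp u
      exact ⟨x, (hmem x).2 ⟨hx, hx1⟩, hx2⟩)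
  obtain ⟨hpD, hpu⟩ := (hmem p).1 hp
  refine ⟨p.1, energy (mulOp hV) p, hp1, hpu, ?_, fun x hx hxu => hmin x ((hmem x).2 ⟨hx, hxu⟩)⟩
  rw [mem_schrodingerGraph_iff hV]
  refine ⟨p.2, hpD, fun x hx => ?_⟩
  obtain ⟨u', hu'⟩ := exists_sobolev_of_mem_graph hu
  -- Projection of `x` onto the complement of `u`. The case `u = 0` is allowed: division by zero
  -- gives `c = 0`.
  set c := inner ℝ u x.1 / ‖u‖ ^ 2 with hc
  have hy : x - c • (u, u') ∈ K := by
    refine (hmem _).2 ⟨Submodule.sub_mem _ hx (Submodule.smul_mem _ _ hu'), ?_⟩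
    rw [Prod.fst_sub, Prod.smul_fst, inner_sub_right, inner_smul_right, real_inner_self_eq_norm_sq]
    by_cases h0 : u = 0
    · simp [h0]
    · rw [hc, div_mul_cancel₀ _ (by simpa using h0), sub_self]
  have h1 := energyForm_eq_of_minimizer hsymm K hp hp1 hmin hy
  -- The form does not couple `p` to the eigenfunction `u`, so the Euler–Lagrange equation on `K`
  -- extends to the whole form domain.
  have h2 : energyForm (mulOp hV) p (u, u') = 0 := by
    rw [energyForm_comm hsymm, energyForm_eq_of_mem_graph hV hu' hu hpD, hpu, mul_zero]
  have h3 : energyForm (mulOp hV) p (x - c • (u, u'))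
      = energyForm (mulOp hV) p x - c * energyForm (mulOp hV) p (u, u') := by
    simp only [energyForm, Prod.fst_sub, Prod.snd_sub, Prod.smul_fst, Prod.smul_snd,
      inner_sub_right, inner_smul_right]
    ring
  have h4 : inner ℝ p.1 (x - c • (u, u')).1 = inner ℝ p.1 x.1 := by
    rw [Prod.fst_sub, Prod.smul_fst, inner_sub_right, inner_smul_right, real_inner_comm u,
      hpu, mul_zero, sub_zero]
  rw [h3, h2, h4, mul_zero, sub_zero] at h1
  rw [inner_smul_left, Prod.mk.eta, h1]
  rfl

-- Needed because `sInf` of a set unbounded below is `0` by default; for `k = 0` the set is all of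
-- `ℝ`.
include hV in
lemma bddBelow_eigenvalue_set {k : ℕ} (hk : 0 < k) :
    BddBelow {t | ∃ v : Fin k → M.L2, LinearIndependent ℝ v ∧
      ∀ i, ∃ μ : ℝ, μ ≤ t ∧ (v i, μ • v i) ∈ M.schrodingerGraph V} := by
  refine ⟨-‖mulOp hV‖, ?_⟩
  rintro t ⟨v, hv, h⟩
  obtain ⟨μ, hμ, hμv⟩ := h ⟨0, hk⟩
  refine le_trans ?_ hμ
  obtain ⟨v', hv'⟩ := exists_sobolev_of_mem_graph hμv
  have h1 := energy_eq_of_mem_graph hV hv' hμv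
  have h2 := energy_ge (A := mulOp hV) (v ⟨0, hk⟩, v')
  rw [h1] at h2
  have h3 : 0 < ‖v ⟨0, hk⟩‖ ^ 2 := by
    have := norm_pos_iff.2 (hv.ne_zero ⟨0, hk⟩)
    positivity
  have h4 := sq_nonneg ‖v'‖
  by_contra hcon
  simp only at h2
  nlinarith

include hV in
lemma eigenvalue_one_le {v : M.L2} {μ : ℝ} (hv : v ≠ 0)
    (h : (v, μ • v) ∈ M.schrodingerGraph V) : M.eigenvalue V 1 ≤ μ :=
  csInf_le (bddBelow_eigenvalue_set hV one_pos)
    ⟨fun _ => v, LinearIndependent.of_subsingleton 0 hv, fun _ => ⟨μ, le_rfl, h⟩⟩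

lemma mem_eigenvalue_set_two {u w : M.L2} {μ₀ μ : ℝ} (hu : u ≠ 0) (hw : w ≠ 0)
    (huw : inner ℝ u w = 0) (h₀ : μ₀ ≤ μ) (h : (u, μ₀ • u) ∈ M.schrodingerGraph V)
    (h' : (w, μ • w) ∈ M.schrodingerGraph V) :
    μ ∈ {t | ∃ v : Fin 2 → M.L2, LinearIndependent ℝ v ∧
      ∀ i, ∃ μ : ℝ, μ ≤ t ∧ (v i, μ • v i) ∈ M.schrodingerGraph V} := by
  refine ⟨![u, w], ?_, ?_⟩
  · rw [LinearIndependent.pair_iff' hu]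
    rintro a rfl
    rw [inner_smul_right, real_inner_self_eq_norm_sq] at huw
    have : a = 0 := by
      rcases mul_eq_zero.1 huw with h | h
      · exact h
      · exact absurd (by simpa using h) hu
    exact hw (by rw [this, zero_smul])
  · intro i
    fin_cases i
    · exact ⟨μ₀, h₀, h⟩
    · exact ⟨μ, le_rfl, h'⟩

/-- The first eigenvalue is the minimum of the energy. -/
theorem exists_ground_state : ∃ u : M.L2, ‖u‖ = 1 ∧
    (u, M.eigenvalue V 1 • u) ∈ M.schrodingerGraph V ∧
    ∀ x ∈ M.sobolevSubmodule, M.eigenvalue V 1 * ‖x.1‖ ^ 2 ≤ energy (mulOp hV) x := by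
  -- Orthogonality to the zero vector is no constraint, so the constrained minimization also yields
  -- the ground state.
  have h0 : ((0 : M.L2), (0 : ℝ) • (0 : M.L2)) ∈ M.schrodingerGraph V := by
    rw [mem_schrodingerGraph_iff hV]
    refine ⟨0, Submodule.zero_mem _, fun x _ => ?_⟩
    simp [energyForm]
  obtain ⟨w, μ, hw, -, hwμ, hmin⟩ := exists_eigenfunction_perp hV h0
  have hw0 : w ≠ 0 := by
    rintro rfl
    simp at hw
  have hmin' : ∀ x ∈ M.sobolevSubmodule, μ * ‖x.1‖ ^ 2 ≤ energy (mulOp hV) x :=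
    fun x hx => hmin x hx (inner_zero_left _)
  have hμ : M.eigenvalue V 1 = μ := by
    refine le_antisymm (eigenvalue_one_le hV hw0 hwμ) (le_csInf ⟨μ, fun _ => w,
      LinearIndependent.of_subsingleton 0 hw0, fun _ => ⟨μ, le_rfl, hwμ⟩⟩ ?_)
    rintro t ⟨v, hv, h⟩
    obtain ⟨η, hη, hηv⟩ := h 0
    refine le_trans ?_ hη
    obtain ⟨v', hv'⟩ := exists_sobolev_of_mem_graph hηv
    have h1 := hmin' _ hv'
    rw [energy_eq_of_mem_graph hV hv' hηv] at h1
    have h3 : 0 < ‖v 0‖ ^ 2 := by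
      have := norm_pos_iff.2 (hv.ne_zero 0)
      positivity
    exact le_of_mul_le_mul_right h1 h3
  exact ⟨w, hw, by rwa [hμ], by rwa [hμ]⟩

-- Lower bounds for `λ₂` need this, since `sInf ∅` is `0` by default.
include hV in
lemma eigenvalue_two_set_nonempty : {t | ∃ v : Fin 2 → M.L2, LinearIndependent ℝ v ∧
      ∀ i, ∃ μ : ℝ, μ ≤ t ∧ (v i, μ • v i) ∈ M.schrodingerGraph V}.Nonempty := by
  obtain ⟨u, hu, huV, -⟩ := exists_ground_state hV
  obtain ⟨w, μ, hw, huw, hwμ, -⟩ := exists_eigenfunction_perp hV huV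
  have hw0 : w ≠ 0 := by
    rintro rfl
    simp at hw
  have hu0 : u ≠ 0 := by
    rintro rfl
    simp at hu
  exact ⟨μ, mem_eigenvalue_set_two hu0 hw0 huw (eigenvalue_one_le hV hw0 hwμ) huV hwμ⟩

/-- The variational bound for the second eigenvalue. -/
theorem eigenvalue_two_mul_le_energy {u : M.L2} (hu : u ≠ 0)
    (huV : (u, M.eigenvalue V 1 • u) ∈ M.schrodingerGraph V) {x : M.L2 × M.L2}
    (hx : x ∈ M.sobolev) (hxu : inner ℝ u x.1 = 0) :
    M.eigenvalue V 2 * ‖x.1‖ ^ 2 ≤ energy (mulOp hV) x := by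
  obtain ⟨w, μ, hw, huw, hwμ, hmin⟩ := exists_eigenfunction_perp hV huV
  have hw0 : w ≠ 0 := by
    rintro rfl
    simp at hw
  have h : M.eigenvalue V 2 ≤ μ := csInf_le (bddBelow_eigenvalue_set hV two_pos)
    (mem_eigenvalue_set_two hu hw0 huw (eigenvalue_one_le hV hw0 hwμ) huV hwμ)
  exact (mul_le_mul_of_nonneg_right h (sq_nonneg _)).trans (hmin x hx hxu)

end ArcLengthCurve

/-! ### The commutator argument for a single multiplier. -/

section Multiplication

open scoped ENNReal

variable {α : Type*} [MeasurableSpace α] {μ : Measure α}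

lemma mulOp_comm {F G : α → ℝ} (hF : MemLp F ∞ μ) (hG : MemLp G ∞ μ) (u : Lp ℝ 2 μ) :
    mulOp hF (mulOp hG u) = mulOp hG (mulOp hF u) := by
  refine Lp.ext ?_
  filter_upwards [coeFn_mulOp hF (mulOp hG u), coeFn_mulOp hG (mulOp hF u), coeFn_mulOp hF u,
    coeFn_mulOp hG u] with x h1 h2 h3 h4
  rw [h1, h2, h3, h4]
  ring

end Multiplication

namespace ArcLengthCurve

open scoped ENNReal

variable {ν : ℕ} {M : ArcLengthCurve ν} {V : ℝ → ℝ}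

/-- The first commutator identity combined with the variational bound for `λ₂`. -/
lemma gap_mul_norm_sq_le (hV : MemLp V ∞ M.arcMeasure) {u u' : M.L2} (hu0 : u ≠ 0)
    (hu' : (u, u') ∈ M.sobolev) (hu : (u, M.eigenvalue V 1 • u) ∈ M.schrodingerGraph V)
    {G : ℝ → ℝ} (hG : M.IsMultiplier G) (h : MemLp G ∞ M.arcMeasure)
    (h' : MemLp (deriv G) ∞ M.arcMeasure) (hperp : inner ℝ u (mulOp h u) = 0) :
    M.gap V * ‖mulOp h u‖ ^ 2 ≤ ‖mulOp h' u‖ ^ 2 := by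
  have hx := hG.mul_mem_sobolev h h' hu'
  have hy := hG.mul_mem_sobolev h h' hx
  have h1 := eigenvalue_two_mul_le_energy hV hu0 hu hx hperp
  -- Testing with `G²u` uses only the form domain. The cross terms agree with those of `‖(Gu)'‖²`,
  -- and the difference is `‖G'u‖²`.
  have h2 := energyForm_eq_of_mem_graph hV hu' hu hy
  have e1 : inner ℝ u' (mulOp h' (mulOp h u)) = inner ℝ (mulOp h' u) (mulOp h u') := by
    rw [mulOp_comm h' h, ← mulOp_symm h, real_inner_comm]
  have e2 : inner ℝ u' (mulOp h (mulOp h' u)) = inner ℝ (mulOp h' u) (mulOp h u') := by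
    rw [← mulOp_symm h, real_inner_comm]
  have e3 : inner ℝ u' (mulOp h (mulOp h u')) = ‖mulOp h u'‖ ^ 2 := by
    rw [← mulOp_symm h, real_inner_self_eq_norm_sq]
  have e4 : inner ℝ (mulOp hV u) (mulOp h (mulOp h u))
      = inner ℝ (mulOp hV (mulOp h u)) (mulOp h u) := by
    rw [← mulOp_symm h, mulOp_comm h hV]
  have e5 : inner ℝ u (mulOp h (mulOp h u)) = ‖mulOp h u‖ ^ 2 := by
    rw [← mulOp_symm h, real_inner_self_eq_norm_sq]
  simp only [energy, energyForm, map_add, inner_add_left, inner_add_right,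
    real_inner_self_eq_norm_sq] at h1 h2
  rw [e1, e2, e3, e4, e5] at h2
  rw [real_inner_comm (mulOp h' u)] at h1
  rw [gap]
  linarith

/-- Integration by parts for `(G G' u²)'`. -/
lemma norm_mulOp_deriv_sq {u u' : M.L2} (hu' : (u, u') ∈ M.sobolev)
    {G : ℝ → ℝ} (hG : M.IsMultiplier G) (h : MemLp G ∞ M.arcMeasure)
    (h' : MemLp (deriv G) ∞ M.arcMeasure) {w : M.L2}
    (hw : w =ᵐ[M.arcMeasure] fun s => deriv (deriv G) s * u s) :
    ‖mulOp h' u‖ ^ 2 = - inner ℝ (mulOp h u) (w + (2 : ℝ) • mulOp h' u') := by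
  have key : inner ℝ (mulOp h' u) (mulOp h' u) + inner ℝ (mulOp h u) w
      + inner ℝ (mulOp h u') (mulOp h' u) + inner ℝ (mulOp h u) (mulOp h' u') = 0 := by
    -- Only one factor of `u²` is approximated by test functions `φ`. Then `GG'φ` is itself a test
    -- function, and no bound on `G''` is required beyond `G''u ∈ L²`.
    refine sobolev_induction (p := (u, u'))
      (P := fun q => inner ℝ (mulOp h' q.1) (mulOp h' u) + inner ℝ (mulOp h q.1) w
      + inner ℝ (mulOp h q.2) (mulOp h' u) + inner ℝ (mulOp h q.1) (mulOp h' u') = 0) ?_ ?_ hu'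
    · exact isClosed_eq (by fun_prop) continuous_const
    · intro q φ hφ h1 h2
      have i1 := integrable_mul_L2 (mulOp h' q.1) (mulOp h' u)
      have i2 := integrable_mul_L2 (mulOp h q.1) w
      have i3 := integrable_mul_L2 (mulOp h q.2) (mulOp h' u)
      have i4 := integrable_mul_L2 (mulOp h q.1) (mulOp h' u')
      rw [← integral_weak_deriv_test hu' ((hG.mul hG.deriv).mul_test hφ),
        inner_eq_integral_mul, inner_eq_integral_mul, inner_eq_integral_mul, inner_eq_integral_mul,
        ← integral_add' i1 i2, ← integral_add' (i1.add i2) i3,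
        ← integral_add' ((i1.add i2).add i3) i4]
      · have hd : ∀ s ∈ Ioo 0 M.length, deriv (fun s => G s * deriv G s * φ s) s
            = (deriv G s * deriv G s + G s * deriv (deriv G) s) * φ s
              + G s * deriv G s * deriv φ s := fun s hs =>
          (((hG.differentiableAt hs).hasDerivAt.mul
            (hG.deriv.differentiableAt hs).hasDerivAt).mul (hφ.differentiable s).hasDerivAt).deriv
        refine integral_congr_ae ?_
        filter_upwards [coeFn_mulOp h' q.1, coeFn_mulOp h' u, coeFn_mulOp h q.1, coeFn_mulOp h q.2,
          coeFn_mulOp h' u', h1, h2, hw, ae_arcMeasure hd] with s a1 a2 a3 a4 a5 a6 a7 a8 a9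
        simp only [Pi.add_apply]
        rw [a1, a2, a3, a4, a5, a6, a7, a8, a9]
        ring
  have e : inner ℝ (mulOp h u') (mulOp h' u) = inner ℝ (mulOp h u) (mulOp h' u') := by
    rw [mulOp_symm h, mulOp_comm, ← mulOp_symm h', real_inner_comm]
  rw [e, real_inner_self_eq_norm_sq] at key
  rw [inner_add_right, inner_smul_right]
  linarith

/-- The gap inequality for one multiplier. -/
lemma gap_mul_norm_deriv_sq_le (hV : MemLp V ∞ M.arcMeasure) {u u' : M.L2} (hu1 : ‖u‖ = 1)
    (hu' : (u, u') ∈ M.sobolev) (hu : (u, M.eigenvalue V 1 • u) ∈ M.schrodingerGraph V)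
    {X : ℝ → ℝ} (hX : M.IsMultiplier X) (h : MemLp X ∞ M.arcMeasure)
    (h' : MemLp (deriv X) ∞ M.arcMeasure) {w : M.L2}
    (hw : w =ᵐ[M.arcMeasure] fun s => deriv (deriv X) s * u s) :
    M.gap V * ‖mulOp h' u‖ ^ 2 ≤ ‖w + (2 : ℝ) • mulOp h' u'‖ ^ 2 := by
  have hu0 : u ≠ 0 := by
    rintro rfl
    simp at hu1
  -- Subtracting the mean of `X` against `u²` makes `Gu` orthogonal to `u` and leaves the
  -- derivatives unchanged.
  set c := inner ℝ u (mulOp h u) with hc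
  have hd : deriv (fun s => X s - c) = deriv X := by
    funext s
    exact deriv_sub_const c
  have hG : M.IsMultiplier fun s => X s - c := hX.sub (.const c)
  have hGm : MemLp (fun s => X s - c) ∞ M.arcMeasure := h.sub (memLp_const c)
  have hGm' : MemLp (deriv fun s => X s - c) ∞ M.arcMeasure := by rwa [hd]
  have hop : ∀ v, mulOp hGm' v = mulOp h' v := fun v => by
    refine Lp.ext ?_
    filter_upwards [coeFn_mulOp hGm' v, coeFn_mulOp h' v] with s h1 h2
    rw [h1, h2, hd]
  have hperp : inner ℝ u (mulOp hGm u) = 0 := by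
    have : mulOp hGm u = mulOp h u - c • u := by
      refine Lp.ext ?_
      filter_upwards [coeFn_mulOp hGm u, coeFn_mulOp h u, Lp.coeFn_sub (mulOp h u) (c • u),
        Lp.coeFn_smul c u] with s h1 h2 h3 h4
      rw [h1, h3, Pi.sub_apply, h2, h4, Pi.smul_apply, smul_eq_mul]
      ring
    rw [this, inner_sub_right, inner_smul_right, real_inner_self_eq_norm_sq, hu1, ← hc]
    ring
  have h1 := gap_mul_norm_sq_le hV hu0 hu' hu hG hGm hGm' hperp
  have h2 := norm_mulOp_deriv_sq hu' hG hGm hGm' (w := w) (by rwa [hd])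
  rw [hop] at h1
  rw [hop, hop] at h2
  set b := w + (2 : ℝ) • mulOp h' u'
  set a := ‖mulOp h' u‖ ^ 2
  have ha : 0 ≤ a := sq_nonneg _
  have h3 : a ≤ ‖mulOp hGm u‖ * ‖b‖ := by
    rw [h2, ← inner_neg_left, ← norm_neg (mulOp hGm u)]
    exact real_inner_le_norm _ _
  rcases le_or_gt (M.gap V) 0 with hg | hg
  · exact (mul_nonpos_of_nonpos_of_nonneg hg ha).trans (sq_nonneg _)
  · rcases ha.eq_or_lt with h0 | h0
    · rw [← h0, mul_zero]; exact sq_nonneg _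
    -- With an extra factor `a`, Cauchy–Schwarz brings in `‖Gu‖²`, and `Γ‖Gu‖² ≤ a` removes it
    -- again.
    · refine le_of_mul_le_mul_right ?_ h0
      calc M.gap V * a * a = M.gap V * a ^ 2 := by ring
        _ ≤ M.gap V * (‖mulOp hGm u‖ * ‖b‖) ^ 2 := by gcongr
        _ = (M.gap V * ‖mulOp hGm u‖ ^ 2) * ‖b‖ ^ 2 := by ring
        _ ≤ a * ‖b‖ ^ 2 := by gcongr
        _ = ‖b‖ ^ 2 * a := by ring

/-! ### Cartesian coordinates along the curve, and the gap bound. -/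

section Coordinates

variable (M) in
/-- The `k`-th Cartesian coordinate along the curve. -/
def coord (k : Fin ν) (s : ℝ) : ℝ := M.toFun s k

lemma isMultiplier_coord (k : Fin ν) : M.IsMultiplier (M.coord k) := by
  refine ⟨?_, fun hc => ⟨?_, ?_⟩⟩
  · exact contDiffOn_euclidean.1 M.smooth k
  · exact contDiff_euclidean.1 (M.closed hc).1 k
  · intro s
    simp only [coord, (M.closed hc).2 s]

lemma hasDerivAt_toFun {s : ℝ} (hs : s ∈ Ioo 0 M.length) :
    HasDerivAt M.toFun (deriv M.toFun s) s :=
  ((M.smooth.contDiffAt (isOpen_Ioo.mem_nhds hs)).differentiableAt (by simp)).hasDerivAt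

lemma contDiffOn_deriv : ContDiffOn ℝ ∞ (deriv M.toFun) (Ioo 0 M.length) :=
  M.smooth.deriv_of_isOpen isOpen_Ioo (by simp)

lemma hasDerivAt_deriv {s : ℝ} (hs : s ∈ Ioo 0 M.length) :
    HasDerivAt (deriv M.toFun) (deriv (deriv M.toFun) s) s :=
  ((contDiffOn_deriv.contDiffAt (isOpen_Ioo.mem_nhds hs)).differentiableAt (by simp)).hasDerivAt

lemma deriv_coord (k : Fin ν) {s : ℝ} (hs : s ∈ Ioo 0 M.length) :
    deriv (M.coord k) s = deriv M.toFun s k :=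
  ((EuclideanSpace.proj (𝕜 := ℝ) k).hasFDerivAt.comp_hasDerivAt s (hasDerivAt_toFun hs)).deriv

lemma deriv_deriv_coord (k : Fin ν) {s : ℝ} (hs : s ∈ Ioo 0 M.length) :
    deriv (deriv (M.coord k)) s = deriv (deriv M.toFun) s k := by
  have h : deriv (M.coord k) =ᶠ[nhds s] fun r => deriv M.toFun r k := by
    filter_upwards [isOpen_Ioo.mem_nhds hs] with r hr
    exact deriv_coord k hr
  rw [h.deriv_eq]
  exact ((EuclideanSpace.proj (𝕜 := ℝ) k).hasFDerivAt.comp_hasDerivAt s (hasDerivAt_deriv hs)).deriv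

lemma sum_deriv_coord_sq {s : ℝ} (hs : s ∈ Ioo 0 M.length) :
    ∑ k, deriv (M.coord k) s ^ 2 = 1 := by
  have h := EuclideanSpace.real_norm_sq_eq (deriv M.toFun s)
  rw [M.unit_speed s hs] at h
  simp only [deriv_coord _ hs]
  linarith

lemma sum_deriv_deriv_coord_sq {s : ℝ} (hs : s ∈ Ioo 0 M.length) :
    ∑ k, deriv (deriv (M.coord k)) s ^ 2 = M.curvature s ^ 2 := by
  simp only [deriv_deriv_coord _ hs, curvature, EuclideanSpace.real_norm_sq_eq]

/-- Differentiate `∑X'² = 1`: the acceleration is normal to the tangent. This cancels the `u u'`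
cross term in the summed inequality. -/
lemma sum_deriv_mul_deriv_deriv_coord {s : ℝ} (hs : s ∈ Ioo 0 M.length) :
    ∑ k, deriv (M.coord k) s * deriv (deriv (M.coord k)) s = 0 := by
  have h1 : HasDerivAt (fun r => ∑ k, deriv (M.coord k) r ^ 2)
      (∑ k, 2 * deriv (M.coord k) s * deriv (deriv (M.coord k)) s) s := by
    refine HasDerivAt.fun_sum fun k _ => ?_
    refine (((isMultiplier_coord k).deriv.differentiableAt hs).hasDerivAt.pow 2).congr_deriv ?_
    simp
  have h2 : (fun r => ∑ k, deriv (M.coord k) r ^ 2) =ᶠ[nhds s] fun _ => 1 := by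
    filter_upwards [isOpen_Ioo.mem_nhds hs] with r hr
    exact sum_deriv_coord_sq hr
  have h3 := h1.unique ((hasDerivAt_const s (1 : ℝ)).congr_of_eventuallyEq h2)
  simp only [mul_assoc, ← Finset.mul_sum] at h3
  linarith

lemma abs_deriv_coord_le (k : Fin ν) {s : ℝ} (hs : s ∈ Ioo 0 M.length) :
    |deriv (M.coord k) s| ≤ 1 := by
  rw [deriv_coord k hs, ← M.unit_speed s hs, ← Real.norm_eq_abs]
  exact PiLp.norm_apply_le _ k

lemma abs_deriv_deriv_coord_le (k : Fin ν) {s : ℝ} (hs : s ∈ Ioo 0 M.length) :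
    |deriv (deriv (M.coord k)) s| ≤ M.curvature s := by
  rw [deriv_deriv_coord k hs, ← Real.norm_eq_abs]
  exact PiLp.norm_apply_le _ k

lemma memLp_deriv_coord (k : Fin ν) : MemLp (deriv (M.coord k)) ∞ M.arcMeasure :=
  memLp_top_of_continuousOn (isMultiplier_coord k).deriv.continuousOn
    fun _ hs => abs_deriv_coord_le k hs

lemma memLp_coord (k : Fin ν) : MemLp (M.coord k) ∞ M.arcMeasure := by
  have hL := M.length_pos
  refine memLp_top_of_continuousOn (isMultiplier_coord k).continuousOn
    (K := |M.coord k (M.length / 2)| + M.length) fun s hs => ?_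
  have hm : M.length / 2 ∈ Ioo 0 M.length := ⟨by linarith, by linarith⟩
  have h := (convex_Ioo 0 M.length).norm_image_sub_le_of_norm_deriv_le (f := M.coord k) (C := 1)
    (fun r hr => (isMultiplier_coord k).differentiableAt hr)
    (fun r hr => abs_deriv_coord_le k hr) hm hs
  rw [one_mul, Real.norm_eq_abs, Real.norm_eq_abs] at h
  have h2 : |s - M.length / 2| ≤ M.length := abs_le.2 ⟨by linarith [hs.1], by linarith [hs.2]⟩
  have h3 := abs_sub_abs_le_abs_sub (M.coord k s) (M.coord k (M.length / 2))
  linarith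

lemma continuousOn_curvature : ContinuousOn M.curvature (Ioo 0 M.length) :=
  (contDiffOn_deriv.continuousOn_deriv_of_isOpen isOpen_Ioo (by simp)).norm

end Coordinates

/-- The gap bound when the right-hand side is finite. -/
theorem gap_le_integral (hV : MemLp V ∞ M.arcMeasure) {u u' : M.L2} (hu1 : ‖u‖ = 1)
    (hu' : (u, u') ∈ M.sobolev) (hu : (u, M.eigenvalue V 1 • u) ∈ M.schrodingerGraph V)
    (hκ : MemLp (fun s => M.curvature s * u s) 2 M.arcMeasure) :
    M.gap V ≤ 4 * ∫ s, ((u' s) ^ 2 + M.curvature s ^ 2 / 4 * (u s) ^ 2) ∂M.arcMeasure := by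
  have hw : ∀ k, MemLp (fun s => deriv (deriv (M.coord k)) s * u s) 2 M.arcMeasure := fun k => by
    refine hκ.mono (((isMultiplier_coord k).deriv.deriv.continuousOn.aestronglyMeasurable
      measurableSet_Ioo).mul (Lp.aestronglyMeasurable u)) ?_
    refine ae_arcMeasure fun s hs => ?_
    rw [norm_mul, norm_mul]
    refine mul_le_mul_of_nonneg_right ?_ (norm_nonneg _)
    exact (abs_deriv_deriv_coord_le k hs).trans (le_abs_self _)
  have h1 : ∀ k, M.gap V * ‖mulOp (memLp_deriv_coord k) u‖ ^ 2
      ≤ ‖(hw k).toLp _ + (2 : ℝ) • mulOp (memLp_deriv_coord k) u'‖ ^ 2 := fun k =>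
    gap_mul_norm_deriv_sq_le hV hu1 hu' hu (isMultiplier_coord k) (memLp_coord k)
      (memLp_deriv_coord k) (hw k).coeFn_toLp
  have h2 := Finset.sum_le_sum fun k (_ : k ∈ Finset.univ) => h1 k
  rw [← Finset.mul_sum] at h2
  have hint : ∀ f : M.L2, Integrable (fun s => f s ^ 2) M.arcMeasure := fun f =>
    (Lp.memLp f).integrable_sq
  have h3 : ∑ k, ‖mulOp (memLp_deriv_coord (M := M) k) u‖ ^ 2 = 1 := by
    have e : ∫ s, u s ^ 2 ∂M.arcMeasure = 1 := by
      rw [← norm_sq_eq_integral, hu1, one_pow]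
    simp only [norm_sq_eq_integral]
    rw [← integral_finsetSum _ fun k _ => hint _, ← e]
    refine integral_congr_ae ?_
    filter_upwards [ae_arcMeasure (M := M) fun s hs => sum_deriv_coord_sq hs,
      ae_all_iff.2 fun k => coeFn_mulOp (memLp_deriv_coord (M := M) k) u] with s a1 a2
    simp only [a2, mul_pow, ← Finset.sum_mul, a1, one_mul]
  have h4 : ∑ k, ‖(hw k).toLp _ + (2 : ℝ) • mulOp (memLp_deriv_coord k) u'‖ ^ 2
      = 4 * ∫ s, ((u' s) ^ 2 + M.curvature s ^ 2 / 4 * (u s) ^ 2) ∂M.arcMeasure := by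
    simp only [norm_sq_eq_integral]
    rw [← integral_finsetSum _ fun k _ => hint _, ← integral_const_mul]
    refine integral_congr_ae ?_
    filter_upwards [ae_arcMeasure (M := M) fun s hs => sum_deriv_coord_sq hs,
      ae_arcMeasure (M := M) fun s hs => sum_deriv_deriv_coord_sq hs,
      ae_arcMeasure (M := M) fun s hs => sum_deriv_mul_deriv_deriv_coord hs,
      ae_all_iff.2 fun k => coeFn_mulOp (memLp_deriv_coord (M := M) k) u',
      ae_all_iff.2 fun k => (hw k).coeFn_toLp,
      ae_all_iff.2 fun k => Lp.coeFn_smul (2 : ℝ) (mulOp (memLp_deriv_coord (M := M) k) u'),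
      ae_all_iff.2 fun k => Lp.coeFn_add ((hw k).toLp _)
        ((2 : ℝ) • mulOp (memLp_deriv_coord (M := M) k) u')] with s a1 a2 a3 a4 a5 a6 a7
    have e : ∀ k, (((hw k).toLp _ + (2 : ℝ) • mulOp (memLp_deriv_coord k) u' : M.L2) s) ^ 2
        = deriv (deriv (M.coord k)) s ^ 2 * u s ^ 2
          + deriv (M.coord k) s * deriv (deriv (M.coord k)) s * (4 * u s * u' s)
          + deriv (M.coord k) s ^ 2 * (4 * u' s ^ 2) := fun k => by
      rw [a7, Pi.add_apply, a5, a6, Pi.smul_apply, a4, smul_eq_mul]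
      ring
    simp only [e, Finset.sum_add_distrib, ← Finset.sum_mul, a1, a2, a3]
    ring
  rw [h3, h4, mul_one] at h2
  exact h2

/-- The gap bound, the right-hand side being possibly infinite. -/
theorem ofReal_gap_le_lintegral (hV : MemLp V ∞ M.arcMeasure) {u u' : M.L2} (hu1 : ‖u‖ = 1)
    (hu' : (u, u') ∈ M.sobolev) (hu : (u, M.eigenvalue V 1 • u) ∈ M.schrodingerGraph V) :
    ENNReal.ofReal (M.gap V) ≤
      4 * ∫⁻ s, ENNReal.ofReal ((u' s) ^ 2 + M.curvature s ^ 2 / 4 * (u s) ^ 2)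
        ∂M.arcMeasure := by
  set f : ℝ → ℝ := fun s => (u' s) ^ 2 + M.curvature s ^ 2 / 4 * (u s) ^ 2 with hf
  have hf0 : ∀ s, 0 ≤ f s := fun s => by positivity
  have hκm : AEStronglyMeasurable M.curvature M.arcMeasure :=
    continuousOn_curvature.aestronglyMeasurable measurableSet_Ioo
  have hfm : AEStronglyMeasurable f M.arcMeasure :=
    by
    have h1 := (Lp.aestronglyMeasurable u').aemeasurable
    have h2 := (Lp.aestronglyMeasurable u).aemeasurable
    have h3 := hκm.aemeasurable
    exact ((h1.pow_const 2).add (((h3.pow_const 2).div_const 4).mul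
      (h2.pow_const 2))).aestronglyMeasurable
  by_cases htop : ∫⁻ s, ENNReal.ofReal (f s) ∂M.arcMeasure = ⊤
  · rw [htop, ENNReal.mul_top (by norm_num)]
    exact le_top
  have hfi : Integrable f M.arcMeasure :=
    (lintegral_ofReal_ne_top_iff_integrable hfm (Filter.Eventually.of_forall hf0)).1 htop
  -- Finiteness of the right-hand side is what puts `κu` in `L²`, because `κ²u² = 4(f - u'²)`.
  have hκ : MemLp (fun s => M.curvature s * u s) 2 M.arcMeasure := by
    refine (memLp_two_iff_integrable_sq (hκm.mul (Lp.aestronglyMeasurable u))).2 ?_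
    refine ((hfi.sub (Lp.memLp u').integrable_sq).const_mul 4).congr ?_
    refine Filter.Eventually.of_forall fun s => ?_
    simp only [hf, Pi.sub_apply, Pi.mul_apply]
    ring
  rw [← ofReal_integral_eq_lintegral_ofReal hfi (Filter.Eventually.of_forall hf0),
    show (4 : ℝ≥0∞) = ENNReal.ofReal 4 by simp, ← ENNReal.ofReal_mul (by norm_num)]
  exact ENNReal.ofReal_le_ofReal (gap_le_integral hV hu1 hu' hu hκ)

end ArcLengthCurve

/-! ### Wirtinger's inequality by Fourier series. -/

lemma fourierCoeffOn_zero_ofReal {L : ℝ} (hL : 0 < L) (φ : ℝ → ℝ) :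
    ‖fourierCoeffOn hL (fun s => (φ s : ℂ)) 0‖ ^ 2 = (∫ s in (0 : ℝ)..L, φ s) ^ 2 / L ^ 2 := by
  rw [fourierCoeffOn_eq_integral]
  simp only [neg_zero, fourier_zero, one_smul, sub_zero]
  rw [intervalIntegral.integral_ofReal, norm_smul, Complex.norm_real, mul_pow, Real.norm_eq_abs,
    Real.norm_eq_abs, sq_abs, sq_abs]
  field_simp

lemma norm_fourierCoeffOn_deriv_sq {L : ℝ} (hL : 0 < L) {φ : ℝ → ℝ} (hφ : Differentiable ℝ φ)
    (hφ' : Continuous (deriv φ)) (h0 : φ 0 = φ L) {n : ℤ} (hn : n ≠ 0) :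
    ‖fourierCoeffOn hL (fun s => ((deriv φ s : ℝ) : ℂ)) n‖ ^ 2
      = (2 * Real.pi * n / L) ^ 2 * ‖fourierCoeffOn hL (fun s => (φ s : ℂ)) n‖ ^ 2 := by
  have h := fourierCoeffOn_of_hasDerivAt hL hn (f := fun s => (φ s : ℂ))
    (f' := fun s => ((deriv φ s : ℝ) : ℂ)) (fun s _ => (hφ s).hasDerivAt.ofReal_comp)
    ((Complex.continuous_ofReal.comp hφ').intervalIntegrable _ _)
  rw [h0, sub_self, mul_zero, zero_sub, Complex.ofReal_zero, sub_zero] at h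
  have hn' : (n : ℝ) ≠ 0 := by exact_mod_cast hn
  have hpi := Real.pi_ne_zero
  rw [h, norm_mul, norm_neg, norm_mul, norm_div]
  simp only [norm_mul, norm_neg, norm_one, Complex.norm_real, Complex.norm_I,
    Complex.norm_intCast, Complex.norm_ofNat, Real.norm_eq_abs, mul_pow, div_pow, sq_abs]
  field_simp

/-- **Wirtinger's inequality**. -/
theorem wirtinger_inequality {L : ℝ} (hL : 0 < L) {φ : ℝ → ℝ} (hφ : Differentiable ℝ φ)
    (hφ' : Continuous (deriv φ)) (h0 : φ 0 = φ L) :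
    (2 * Real.pi / L) ^ 2 * ((∫ s in (0 : ℝ)..L, φ s ^ 2) - (∫ s in (0 : ℝ)..L, φ s) ^ 2 / L)
      ≤ ∫ s in (0 : ℝ)..L, deriv φ s ^ 2 := by
  have hmem : ∀ f : ℝ → ℝ, Continuous f →
      MemLp (fun s => (f s : ℂ)) 2 (volume.restrict (Ioc 0 L)) := fun f hf => by
    obtain ⟨K, hK⟩ := (isCompact_Icc (a := 0) (b := L)).exists_bound_of_continuousOn
      hf.continuousOn
    refine MemLp.of_bound (Complex.continuous_ofReal.comp hf).aestronglyMeasurable K ?_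
    refine (ae_restrict_iff' measurableSet_Ioc).2 (Filter.Eventually.of_forall fun s hs => ?_)
    rw [Complex.norm_real]
    exact hK s (Ioc_subset_Icc_self hs)
  have hP := hasSum_sq_fourierCoeffOn hL (hmem φ hφ.continuous)
  have hP' := hasSum_sq_fourierCoeffOn hL (hmem _ hφ')
  simp only [Complex.norm_real, Real.norm_eq_abs, sq_abs, sub_zero, smul_eq_mul] at hP hP'
  -- Parseval with the mean removed is compared termwise with Parseval for `φ'`, using `n² ≥ 1` for
  -- `n ≠ 0`.
  have hS := ((hP.sub (hasSum_ite_eq (0 : ℤ)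
    (‖fourierCoeffOn hL (fun s => (φ s : ℂ)) 0‖ ^ 2))).mul_left ((2 * Real.pi / L) ^ 2))
  have hle := hasSum_le (fun n => ?_) hS hP'
  · rw [fourierCoeffOn_zero_ofReal] at hle
    have := mul_le_mul_of_nonneg_left hle hL.le
    rw [mul_inv_cancel_left₀ hL.ne'] at this
    refine le_trans (le_of_eq ?_) this
    field_simp
  · by_cases hn : n = 0
    · subst hn
      simp
    · rw [norm_fourierCoeffOn_deriv_sq hL hφ hφ' h0 hn, if_neg hn, sub_zero]
      refine mul_le_mul_of_nonneg_right ?_ (sq_nonneg _)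
      have h1 : (1 : ℝ) ≤ (n : ℝ) ^ 2 := by
        have : (1 : ℤ) ≤ n ^ 2 := Int.add_one_le_iff.2 (sq_pos_of_ne_zero hn)
        exact_mod_cast this
      calc (2 * Real.pi / L) ^ 2 = (2 * Real.pi / L) ^ 2 * 1 := (mul_one _).symm
        _ ≤ (2 * Real.pi / L) ^ 2 * (n : ℝ) ^ 2 := by gcongr
        _ = _ := by ring

/-! ### Constant functions and the potential `gκ²`. -/

namespace ArcLengthCurve

open scoped ENNReal

variable {ν : ℕ} {M : ArcLengthCurve ν} {V : ℝ → ℝ}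

variable (M) in
/-- The constant function `1` in `L²(M)`. -/
def oneL2 : M.L2 := (memLp_two_of_continuous (M := M) (F := fun _ => 1) continuous_const).toLp _

lemma coeFn_oneL2 : M.oneL2 =ᵐ[M.arcMeasure] fun _ => 1 :=
  (memLp_two_of_continuous (M := M) (F := fun _ => 1) continuous_const).coeFn_toLp

lemma inner_oneL2 (u : M.L2) : inner ℝ M.oneL2 u = ∫ s, u s ∂M.arcMeasure := by
  rw [inner_eq_integral_mul]
  refine integral_congr_ae ?_
  filter_upwards [coeFn_oneL2 (M := M)] with s hs
  rw [hs, one_mul]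

lemma norm_oneL2_sq : ‖M.oneL2‖ ^ 2 = M.length := by
  rw [norm_sq_eq_integral_of_ae_eq coeFn_oneL2]
  simp

lemma wirtinger_sobolev {p : M.L2 × M.L2} (hp : p ∈ M.sobolev) :
    (2 * Real.pi / M.length) ^ 2 * (‖p.1‖ ^ 2 - inner ℝ M.oneL2 p.1 ^ 2 / M.length)
      ≤ ‖p.2‖ ^ 2 := by
  refine sobolev_induction (P := fun p => (2 * Real.pi / M.length) ^ 2 *
    (‖p.1‖ ^ 2 - inner ℝ M.oneL2 p.1 ^ 2 / M.length) ≤ ‖p.2‖ ^ 2) ?_ ?_ hp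
  · exact isClosed_le (by fun_prop) (by fun_prop)
  · intro q φ hφ h1 h2
    have h3 : ∫ s, q.1 s ∂M.arcMeasure = ∫ s in (0 : ℝ)..M.length, φ s := by
      rw [← integral_arcMeasure]
      exact integral_congr_ae h1
    rw [norm_sq_eq_integral_of_ae_eq h1, norm_sq_eq_integral_of_ae_eq h2, inner_oneL2, h3]
    exact wirtinger_inequality M.length_pos hφ.differentiable hφ.continuous_deriv hφ.apply_zero_eq

/-- The equality case of Cauchy–Schwarz against the constant `1`. -/
lemma eq_smul_oneL2 {u : M.L2} (h : ‖u‖ ^ 2 ≤ inner ℝ M.oneL2 u ^ 2 / M.length) :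
    u = (inner ℝ M.oneL2 u / M.length) • M.oneL2 := by
  have hL := M.length_pos
  set c := inner ℝ M.oneL2 u / M.length with hc
  have h1 := norm_add_smul_sq u M.oneL2 (-c)
  rw [norm_oneL2_sq, real_inner_comm, neg_smul, ← sub_eq_add_neg] at h1
  have h2 : inner ℝ M.oneL2 u = c * M.length := by rw [hc, div_mul_cancel₀ _ hL.ne']
  have h3 : ‖u‖ ^ 2 ≤ c ^ 2 * M.length := by
    refine h.trans (le_of_eq ?_)
    rw [h2]
    field_simp
  rw [h2] at h1
  have h4 : ‖u - c • M.oneL2‖ ^ 2 = 0 := le_antisymm (by rw [h1]; linarith) (sq_nonneg _)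
  rw [sq_eq_zero_iff, norm_eq_zero] at h4
  exact sub_eq_zero.1 h4

/-- Functions with vanishing derivative are constant. -/
lemma eq_smul_oneL2_of_deriv_eq_zero {u : M.L2} (hu : (u, (0 : M.L2)) ∈ M.sobolev) :
    u = (inner ℝ M.oneL2 u / M.length) • M.oneL2 := by
  refine eq_smul_oneL2 ?_
  have h := wirtinger_sobolev hu
  have hL := M.length_pos
  rw [norm_zero] at h
  have hpos : 0 < (2 * Real.pi / M.length) ^ 2 := by positivity
  have := nonpos_of_mul_nonpos_right (h.trans (by norm_num)) hpos
  linarith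

/-- On an arc, the only constant function in `W_0^1(M)` is zero. -/
lemma closed_of_smul_oneL2_mem {c : ℝ} (hc : c ≠ 0)
    (h : (c • M.oneL2, (0 : M.L2)) ∈ M.sobolev) : M.IsClosedCurve := by
  by_contra hcl
  have hL := M.length_pos
  -- On an arc the boundary terms vanish for every smooth `ψ`; the choice `ψ(s) = s` gives `c ·
  -- length = 0`.
  have h1 := integral_weak_deriv h (ψ := fun s => s) contDiff_id fun φ hφ => by
    rw [← hφ.apply_zero_eq, hφ.apply_zero hcl]; simp
  have h2 : ∫ s, ((c • M.oneL2 : M.L2) s * deriv (fun s : ℝ => s) s + (0 : M.L2) s * s)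
      ∂M.arcMeasure = ∫ _, c ∂M.arcMeasure := by
    refine integral_congr_ae ?_
    filter_upwards [Lp.coeFn_smul c M.oneL2, coeFn_oneL2 (M := M),
      Lp.coeFn_zero ℝ 2 M.arcMeasure] with s a1 a2 a3
    rw [a1, a3, Pi.smul_apply, a2]
    simp
  rw [h2, integral_arcMeasure, intervalIntegral.integral_const, smul_eq_mul, sub_zero] at h1
  exact mul_ne_zero hL.ne' hc h1

/-- A closed curve is not straight. -/
lemma exists_curvature_ne_zero (hcl : M.IsClosedCurve) :
    ∃ s ∈ Ioo 0 M.length, M.curvature s ≠ 0 := by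
  by_contra! hcon
  have hL := M.length_pos
  obtain ⟨hsm, hper⟩ := M.closed hcl
  have hm : M.length / 2 ∈ Ioo 0 M.length := ⟨by linarith, by linarith⟩
  set v := deriv M.toFun (M.length / 2) with hv
  have hderiv : ∀ s ∈ Ioo 0 M.length, deriv M.toFun s = v := fun s hs =>
    isOpen_Ioo.is_const_of_deriv_eq_zero isPreconnected_Ioo
      (fun r hr => (hasDerivAt_deriv hr).differentiableAt.differentiableWithinAt)
      (fun r hr => norm_eq_zero.1 (hcon r hr)) hs hm
  -- A constant tangent `v` integrates to `length • v`, while periodicity makes the integral zero.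
  have hint : ∫ s in (0 : ℝ)..M.length, deriv M.toFun s = M.toFun M.length - M.toFun 0 :=
    intervalIntegral.integral_deriv_eq_sub (fun s _ => hsm.differentiable (by simp) s)
      ((hsm.continuous_deriv (by simp)).intervalIntegrable _ _)
  have hint' : ∫ s in (0 : ℝ)..M.length, deriv M.toFun s = M.length • v := by
    rw [intervalIntegral.integral_of_le hL.le, integral_Ioc_eq_integral_Ioo,
      setIntegral_congr_fun measurableSet_Ioo hderiv]
    simp [hL.le]
  have h0 : M.toFun M.length = M.toFun 0 := by simpa using hper 0
  rw [h0, sub_self, hint', smul_eq_zero] at hint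
  have hv1 : ‖v‖ = 1 := M.unit_speed _ hm
  rcases hint with h | h
  · exact hL.ne' h
  · rw [h, norm_zero] at hv1
    exact zero_ne_one hv1

section CurvaturePotential

variable {g : ℝ}

lemma memLp_curvature (hκ : ∃ K : ℝ, ∀ s ∈ Ioo 0 M.length, M.curvature s ≤ K) :
    MemLp M.curvature ∞ M.arcMeasure := by
  obtain ⟨K, hK⟩ := hκ
  refine memLp_top_of_continuousOn (K := K) continuousOn_curvature fun s hs => ?_
  exact (abs_of_nonneg (norm_nonneg _)).trans_le (hK s hs)

lemma memLp_curvaturePotential (hκ : MemLp M.curvature ∞ M.arcMeasure) (g : ℝ) :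
    MemLp (M.curvaturePotential g) ∞ M.arcMeasure := by
  have h := (hκ.mul (p := ∞) (q := ∞) (r := ∞) hκ).const_mul g
  refine h.ae_eq (Filter.Eventually.of_forall fun s => ?_)
  simp only [curvaturePotential, Pi.mul_apply]
  ring

lemma energy_curvaturePotential (hκ : MemLp M.curvature ∞ M.arcMeasure) (x : M.L2 × M.L2) :
    energy (mulOp (memLp_curvaturePotential hκ g)) x
      = ‖x.2‖ ^ 2 + g * ‖mulOp hκ x.1‖ ^ 2 := by
  rw [energy, energyForm, real_inner_self_eq_norm_sq, inner_mulOp, norm_sq_eq_integral (mulOp _ _),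
    ← integral_const_mul]
  congr 1
  refine integral_congr_ae ?_
  filter_upwards [coeFn_mulOp hκ x.1] with s hs
  rw [hs, curvaturePotential]
  ring

/-- Otherwise `u' = 0` and `κu = 0`; then `u` is a nonzero constant, the curve is closed and `κ`
vanishes, which no closed curve permits. -/
theorem eigenvalue_one_pos (hκ : MemLp M.curvature ∞ M.arcMeasure) (hg : 0 < g) :
    0 < M.eigenvalue (M.curvaturePotential g) 1 := by
  have hV := memLp_curvaturePotential hκ g
  obtain ⟨u, hu1, hu, -⟩ := exists_ground_state hV
  obtain ⟨u', hu'⟩ := exists_sobolev_of_mem_graph hu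
  have h := energy_eq_of_mem_graph hV hu' hu
  rw [energy_curvaturePotential hκ, hu1, one_pow, mul_one] at h
  rw [← h]
  by_contra hcon
  have hsq := sq_nonneg ‖u'‖
  have hsq' := mul_nonneg hg.le (sq_nonneg ‖mulOp hκ u‖)
  simp only at hcon
  have h1 : u' = 0 := by
    have : ‖u'‖ ^ 2 = 0 := by linarith
    simpa using this
  have h2 : mulOp hκ u = 0 := by
    have : g * ‖mulOp hκ u‖ ^ 2 = 0 := by linarith
    simpa [hg.ne'] using this
  rw [h1] at hu'
  have h3 := eq_smul_oneL2_of_deriv_eq_zero hu'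
  set c := inner ℝ M.oneL2 u / M.length
  have hc : c ≠ 0 := by
    intro h0
    rw [h3, h0, zero_smul, norm_zero] at hu1
    exact zero_ne_one hu1
  rw [h3] at hu'
  obtain ⟨s, hs, hs0⟩ := exists_curvature_ne_zero (closed_of_smul_oneL2_mem hc hu')
  refine hs0 (eqOn_of_ae_eq (g := fun _ => 0) ?_ continuousOn_curvature continuousOn_const hs)
  have h4 : mulOp hκ (c • M.oneL2) = 0 := by rw [← h3, h2]
  filter_upwards [coeFn_mulOp hκ (c • M.oneL2), Lp.coeFn_smul c M.oneL2, coeFn_oneL2 (M := M),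
    Lp.coeFn_zero ℝ 2 M.arcMeasure] with r a1 a2 a3 a4
  rw [h4, a4, a2, Pi.smul_apply, a3] at a1
  simpa [hc] using a1.symm

/-- Compare `4‖u'‖² + ‖κu‖²` with `λ₁ = ‖u'‖² + g‖κu‖²` coefficient by coefficient. -/
theorem gap_le_max_mul (hκ : MemLp M.curvature ∞ M.arcMeasure) (hg : 0 < g) :
    M.gap (M.curvaturePotential g) ≤
      max 4 (1 / g) * M.eigenvalue (M.curvaturePotential g) 1 := by
  have hV := memLp_curvaturePotential hκ g
  obtain ⟨u, hu1, hu, -⟩ := exists_ground_state hV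
  obtain ⟨u', hu'⟩ := exists_sobolev_of_mem_graph hu
  have h := energy_eq_of_mem_graph hV hu' hu
  rw [energy_curvaturePotential hκ, hu1, one_pow, mul_one] at h
  have hκu : MemLp (fun s => M.curvature s * u s) 2 M.arcMeasure :=
    (Lp.memLp (mulOp hκ u)).ae_eq (coeFn_mulOp hκ u)
  have h1 := gap_le_integral hV hu1 hu' hu hκu
  have h2 : 4 * ∫ s, ((u' s) ^ 2 + M.curvature s ^ 2 / 4 * (u s) ^ 2) ∂M.arcMeasure
      = 4 * ‖u'‖ ^ 2 + ‖mulOp hκ u‖ ^ 2 := by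
    rw [norm_sq_eq_integral, norm_sq_eq_integral, ← integral_const_mul, ← integral_const_mul,
      ← integral_add ((Lp.memLp u').integrable_sq.const_mul 4)
        (Lp.memLp (mulOp hκ u)).integrable_sq]
    refine integral_congr_ae ?_
    filter_upwards [coeFn_mulOp hκ u] with s hs
    rw [hs]
    ring
  rw [h2] at h1
  rw [← h]
  refine h1.trans ?_
  rw [mul_add, ← mul_assoc]
  have h4 : 1 ≤ max 4 (1 / g) * g := by
    calc (1 : ℝ) = 1 / g * g := by field_simp
      _ ≤ _ := by gcongr; exact le_max_right _ _
  have h5 := mul_le_mul_of_nonneg_right h4 (sq_nonneg ‖mulOp hκ u‖)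
  have h6 := mul_le_mul_of_nonneg_right (le_max_left 4 (1 / g)) (sq_nonneg ‖u'‖)
  simp only
  linarith

end CurvaturePotential

end ArcLengthCurve

/-! ### Closed curves of constant curvature, and circles. -/

namespace ArcLengthCurve

open scoped ENNReal

variable {ν : ℕ} {M : ArcLengthCurve ν} {g κ₀ : ℝ}

lemma oneL2_mem_sobolev (hcl : M.IsClosedCurve) : (M.oneL2, (0 : M.L2)) ∈ M.sobolev := by
  refine subset_closure ⟨fun _ => 1,
    ⟨contDiff_const, fun _ _ => rfl, fun h => absurd hcl h⟩, coeFn_oneL2, ?_⟩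
  filter_upwards [Lp.coeFn_zero ℝ 2 M.arcMeasure] with s hs
  rw [hs, deriv_const]
  rfl

lemma mulOp_const_curvature (hκ : MemLp M.curvature ∞ M.arcMeasure)
    (hκ₀ : ∀ s ∈ Ioo 0 M.length, M.curvature s = κ₀) (u : M.L2) : mulOp hκ u = κ₀ • u := by
  refine Lp.ext ?_
  filter_upwards [coeFn_mulOp hκ u, Lp.coeFn_smul κ₀ u, ae_arcMeasure hκ₀] with s a1 a2 a3
  rw [a1, a2, a3, Pi.smul_apply, smul_eq_mul]

lemma energy_const_curvature (hκ : MemLp M.curvature ∞ M.arcMeasure)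
    (hκ₀ : ∀ s ∈ Ioo 0 M.length, M.curvature s = κ₀) (x : M.L2 × M.L2) :
    energy (mulOp (memLp_curvaturePotential hκ g)) x
      = ‖x.2‖ ^ 2 + g * κ₀ ^ 2 * ‖x.1‖ ^ 2 := by
  rw [energy_curvaturePotential hκ, mulOp_const_curvature hκ hκ₀, norm_smul, mul_pow,
    Real.norm_eq_abs, sq_abs, mul_assoc]

lemma eigenvalue_one_const_curvature (hcl : M.IsClosedCurve)
    (hκ : MemLp M.curvature ∞ M.arcMeasure)
    (hκ₀ : ∀ s ∈ Ioo 0 M.length, M.curvature s = κ₀) :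
    M.eigenvalue (M.curvaturePotential g) 1 = g * κ₀ ^ 2 := by
  have hV := memLp_curvaturePotential hκ g
  refine le_antisymm ?_ ?_
  · have hone : M.oneL2 ≠ 0 := by
      intro h
      have := norm_oneL2_sq (M := M)
      rw [h, norm_zero] at this
      linarith [M.length_pos]
    refine eigenvalue_one_le hV hone ((mem_schrodingerGraph_iff hV).2
      ⟨0, oneL2_mem_sobolev hcl, fun x _ => ?_⟩)
    have h : mulOp hV M.oneL2 = (g * κ₀ ^ 2) • M.oneL2 := by
      refine Lp.ext ?_
      filter_upwards [coeFn_mulOp hV M.oneL2, Lp.coeFn_smul (g * κ₀ ^ 2) M.oneL2,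
        ae_arcMeasure hκ₀] with s a1 a2 a3
      rw [a1, a2, curvaturePotential, a3, Pi.smul_apply, smul_eq_mul]
    rw [energyForm, inner_zero_left, zero_add, h]
  · obtain ⟨u, hu1, hu, -⟩ := exists_ground_state hV
    obtain ⟨u', hu'⟩ := exists_sobolev_of_mem_graph hu
    have h := energy_eq_of_mem_graph hV hu' hu
    rw [energy_const_curvature hκ hκ₀, hu1, one_pow, mul_one, mul_one] at h
    linarith [sq_nonneg ‖u'‖]

/-- An eigenfunction with eigenvalue below `gκ₀² + (2π/L)²` is constant. -/
lemma eigenfunction_eq_smul_oneL2 (hcl : M.IsClosedCurve)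
    (hκ : MemLp M.curvature ∞ M.arcMeasure)
    (hκ₀ : ∀ s ∈ Ioo 0 M.length, M.curvature s = κ₀) {v : M.L2} {μ : ℝ}
    (hv : (v, μ • v) ∈ M.schrodingerGraph (M.curvaturePotential g))
    (hμ : μ < g * κ₀ ^ 2 + (2 * Real.pi / M.length) ^ 2) :
    v = (inner ℝ M.oneL2 v / M.length) • M.oneL2 := by
  have hV := memLp_curvaturePotential hκ g
  have hL := M.length_pos
  obtain ⟨v', hv'⟩ := exists_sobolev_of_mem_graph hv
  have h1 := energy_eq_of_mem_graph hV hv' hv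
  rw [energy_const_curvature hκ hκ₀] at h1
  have h2 := energyForm_eq_of_mem_graph hV hv' hv (oneL2_mem_sobolev hcl)
  have h3 : mulOp hV v = (g * κ₀ ^ 2) • v := by
    refine Lp.ext ?_
    filter_upwards [coeFn_mulOp hV v, Lp.coeFn_smul (g * κ₀ ^ 2) v,
      ae_arcMeasure hκ₀] with s a1 a2 a3
    rw [a1, a2, curvaturePotential, a3, Pi.smul_apply, smul_eq_mul]
  rw [energyForm, inner_zero_right, zero_add, h3, real_inner_smul_left,
    real_inner_comm] at h2
  have h4 := wirtinger_sobolev hv'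
  refine eq_smul_oneL2 ?_
  set τ := (2 * Real.pi / M.length) ^ 2 with hτ
  have hτ0 : 0 < τ := by have := Real.pi_pos; positivity
  simp only at h1 h4
  -- If `v` has mean zero, Wirtinger and the bound on `μ` force `v = 0`. Otherwise testing with `1`
  -- gives `μ = gκ₀²`, and then `v' = 0`.
  rcases eq_or_ne (inner ℝ M.oneL2 v) 0 with h0 | h0
  · rw [h0] at h4
    have h5 : 0 ≤ (g * κ₀ ^ 2 + τ - μ) * ‖v‖ ^ 2 := mul_nonneg (by linarith) (sq_nonneg _)
    have h6 : (g * κ₀ ^ 2 + τ - μ) * ‖v‖ ^ 2 ≤ 0 := by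
      have : τ * ‖v‖ ^ 2 ≤ ‖v'‖ ^ 2 := by simpa using h4
      nlinarith
    rcases mul_eq_zero.1 (le_antisymm h6 h5) with h7 | h7
    · linarith
    · rw [h7, h0]; simp
  · have h5 : g * κ₀ ^ 2 = μ := mul_right_cancel₀ h0 h2
    rw [h5] at h1
    have h6 : ‖v'‖ ^ 2 = 0 := by linarith
    rw [h6] at h4
    have := nonpos_of_mul_nonpos_right h4 hτ0
    linarith

/-- Below this level every eigenfunction is a multiple of `1`, so no two are independent. The
opposite inequality for circles with `g ≤ 1/4` comes from the gap bound. -/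
lemma eigenvalue_two_const_curvature_ge (hcl : M.IsClosedCurve)
    (hκ : MemLp M.curvature ∞ M.arcMeasure)
    (hκ₀ : ∀ s ∈ Ioo 0 M.length, M.curvature s = κ₀) :
    g * κ₀ ^ 2 + (2 * Real.pi / M.length) ^ 2 ≤ M.eigenvalue (M.curvaturePotential g) 2 := by
  refine le_csInf (eigenvalue_two_set_nonempty (memLp_curvaturePotential hκ g)) ?_
  rintro t ⟨v, hv, h⟩
  by_contra! hcon
  have hconst : ∀ i, v i = (inner ℝ M.oneL2 (v i) / M.length) • M.oneL2 := fun i => by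
    obtain ⟨μ, hμ, hμv⟩ := h i
    exact eigenfunction_eq_smul_oneL2 hcl hκ hκ₀ hμv (hμ.trans_lt hcon)
  set c : Fin 2 → ℝ := fun i => inner ℝ M.oneL2 (v i) / M.length with hc
  have hc1 : c 1 = 0 := by
    -- Since `v i = c i • 1`, the combination `c 1 • v 0 - c 0 • v 1` vanishes.
    refine Fintype.linearIndependent_iff.1 hv ![c 1, -c 0] ?_ 0
    rw [Fin.sum_univ_two, hconst 0, hconst 1]
    simp only [Matrix.cons_val_zero, Matrix.cons_val_one, smul_smul, ← add_smul]
    rw [show c 1 * (inner ℝ M.oneL2 (v 0) / M.length)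
      + -c 0 * (inner ℝ M.oneL2 (v 1) / M.length) = 0 by simp only [hc]; ring, zero_smul]
  refine hv.ne_zero 1 ?_
  rw [hconst 1, show inner ℝ M.oneL2 (v 1) / M.length = 0 from hc1, zero_smul]

lemma curvature_circle (R : ℝ) (hR : 0 < R) (c : EuclideanSpace ℝ (Fin ν))
    (e : Fin 2 → EuclideanSpace ℝ (Fin ν)) (he : Orthonormal ℝ e) (s : ℝ) :
    (circle R hR c e he).curvature s = 1 / R := by
  have h1 : deriv (circle R hR c e he).toFun
      = fun s => (- Real.sin (s / R)) • e 0 + Real.cos (s / R) • e 1 := by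
    funext s
    have h1 : HasDerivAt (fun s : ℝ => R * Real.cos (s / R)) (- Real.sin (s / R)) s := by
      refine (((hasDerivAt_id' s).div_const R).cos.const_mul R).congr_deriv ?_
      field_simp
    have h2 : HasDerivAt (fun s : ℝ => R * Real.sin (s / R)) (Real.cos (s / R)) s := by
      refine (((hasDerivAt_id' s).div_const R).sin.const_mul R).congr_deriv ?_
      field_simp
    exact (((h1.smul_const (e 0)).add (h2.smul_const (e 1))).const_add c).deriv
  have h2 : deriv (fun s : ℝ => (- Real.sin (s / R)) • e 0 + Real.cos (s / R) • e 1) s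
      = (-(1 / R)) • (Real.cos (s / R) • e 0 + Real.sin (s / R) • e 1) := by
    have h3 := ((hasDerivAt_id' s).div_const R).sin.neg.smul_const (e 0)
    have h4 := ((hasDerivAt_id' s).div_const R).cos.smul_const (e 1)
    refine ((h3.add h4).deriv).trans ?_
    rw [smul_add, smul_smul, smul_smul]
    congr 2 <;> ring
  have h01 : inner ℝ (e 0) (e 1) = (0 : ℝ) := he.2 (by decide)
  have hsq : ‖Real.cos (s / R) • e 0 + Real.sin (s / R) • e 1‖ ^ 2 = 1 := by
    rw [norm_add_sq_real, inner_smul_left, inner_smul_right, h01, norm_smul, norm_smul,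
      he.1 0, he.1 1]
    simp
  have hn : ‖Real.cos (s / R) • e 0 + Real.sin (s / R) • e 1‖ = 1 :=
    (pow_eq_one_iff_of_nonneg (norm_nonneg _) two_ne_zero).1 hsq
  rw [curvature, h1, h2, norm_smul, hn, norm_neg, mul_one, Real.norm_eq_abs,
    abs_of_pos (by positivity)]

lemma eigenvalue_two_div_eigenvalue_one {V : ℝ → ℝ} (h : 0 < M.eigenvalue V 1) :
    M.eigenvalue V 2 / M.eigenvalue V 1 = 1 + M.gap V / M.eigenvalue V 1 := by
  rw [gap]
  field_simp
  ring

/-- Here `(2π/length)² = 1/R² = λ₁/g`, and `g ≤ 1/4` makes the maximum equal to `1/g`, so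
Wirtinger's lower bound meets the general upper bound. -/
theorem gap_circle (hg : 0 < g) (hg' : g ≤ 1 / 4) (hM : M.IsCircle) :
    M.gap (M.curvaturePotential g)
      = max 4 (1 / g) * M.eigenvalue (M.curvaturePotential g) 1 := by
  obtain ⟨R, hR, c, e, he, rfl⟩ := hM
  set C := circle R hR c e he with hC
  have hcurv : ∀ s ∈ Ioo 0 C.length, C.curvature s = 1 / R := fun s _ =>
    curvature_circle R hR c e he s
  have hκ : MemLp C.curvature ∞ C.arcMeasure := memLp_curvature ⟨1 / R, fun s hs => (hcurv s hs).le⟩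
  have hcl : C.IsClosedCurve := trivial
  refine le_antisymm (gap_le_max_mul hκ hg) ?_
  have h1 := eigenvalue_one_const_curvature (g := g) hcl hκ hcurv
  have h2 := eigenvalue_two_const_curvature_ge (g := g) hcl hκ hcurv
  have h3 : 2 * Real.pi / C.length = 1 / R := by
    have : C.length = 2 * Real.pi * R := rfl
    have hpi := Real.pi_ne_zero
    rw [this]
    field_simp
  have h4 : (4 : ℝ) ≤ 1 / g := by
    rw [le_div_iff₀ hg]
    linarith
  rw [gap, max_eq_right h4]
  rw [h3] at h2
  rw [h1]
  have h5 : 1 / g * (g * (1 / R) ^ 2) = (1 / R) ^ 2 := by field_simp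
  linarith

end ArcLengthCurve

end

theorem corollary2p2 (ν : ℕ) (hν : ν = 2 ∨ ν = 3) :
    -- The bound for a bounded measurable potential and a normalized eigenfunction `u` for `λ₁`
    (∀ (M : ArcLengthCurve ν) (V : ℝ → ℝ), AEMeasurable V M.arcMeasure →
      (∃ K : ℝ, ∀ᵐ s ∂M.arcMeasure, |V s| ≤ K) →
      ∀ u u' : M.L2, (u, u') ∈ M.sobolev →
        (u, M.eigenvalue V 1 • u) ∈ M.schrodingerGraph V → ‖u‖ = 1 →
        ENNReal.ofReal (M.gap V) ≤
          4 * ∫⁻ s, ENNReal.ofReal ((u' s) ^ 2 + M.curvature s ^ 2 / 4 * (u s) ^ 2)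
            ∂M.arcMeasure) ∧
    -- The bounds for `H_g` (`κ²` being bounded, as is automatic for compact curves)
    (∀ M : ArcLengthCurve ν, (∃ K : ℝ, ∀ s ∈ Set.Ioo 0 M.length, M.curvature s ≤ K) →
      ∀ g : ℝ, 0 < g →
        M.gap (M.curvaturePotential g) ≤
          max 4 (1 / g) * M.eigenvalue (M.curvaturePotential g) 1 ∧
        0 < M.eigenvalue (M.curvaturePotential g) 1 ∧
        M.eigenvalue (M.curvaturePotential g) 2 / M.eigenvalue (M.curvaturePotential g) 1 ≤
          max 5 (1 + 1 / g)) ∧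
    -- Sharpness: for `0 < g ≤ 1/4` equality holds for every circle
    (∀ g : ℝ, 0 < g → g ≤ 1 / 4 → ∀ C : ArcLengthCurve ν, C.IsCircle →
      C.gap (C.curvaturePotential g) =
          max 4 (1 / g) * C.eigenvalue (C.curvaturePotential g) 1 ∧
      0 < C.eigenvalue (C.curvaturePotential g) 1 ∧
      C.eigenvalue (C.curvaturePotential g) 2 / C.eigenvalue (C.curvaturePotential g) 1 =
          max 5 (1 + 1 / g)) := by
  refine ⟨?_, ?_, ?_⟩
  · rintro M V hVm ⟨K, hK⟩ u u' hu' hu hu1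
    have hV : MemLp V ⊤ M.arcMeasure := memLp_top_of_bound hVm.aestronglyMeasurable K hK
    exact ArcLengthCurve.ofReal_gap_le_lintegral hV hu1 hu' hu
  · intro M hκ g hg
    have hκ' := ArcLengthCurve.memLp_curvature hκ
    have hpos := ArcLengthCurve.eigenvalue_one_pos hκ' hg
    have hgap := ArcLengthCurve.gap_le_max_mul hκ' hg
    refine ⟨hgap, hpos, ?_⟩
    rw [ArcLengthCurve.eigenvalue_two_div_eigenvalue_one hpos,
      show (5 : ℝ) = 1 + 4 by norm_num, max_add_add_left]
    gcongr
    exact (div_le_iff₀ hpos).2 hgap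
  · intro g hg hg' C hC
    have hgap := ArcLengthCurve.gap_circle hg hg' hC
    have hpos : 0 < C.eigenvalue (C.curvaturePotential g) 1 := by
      obtain ⟨R, hR, c, e, he, rfl⟩ := hC
      exact ArcLengthCurve.eigenvalue_one_pos (ArcLengthCurve.memLp_curvature
        ⟨1 / R, fun s _ => (ArcLengthCurve.curvature_circle R hR c e he s).le⟩) hg
    refine ⟨hgap, hpos, ?_⟩
    rw [ArcLengthCurve.eigenvalue_two_div_eigenvalue_one hpos,
      show (5 : ℝ) = 1 + 4 by norm_num, max_add_add_left, hgap,
      mul_div_cancel_right₀ _ hpos.ne']
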